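/- For a real $n\times p$ matrix $\mathbf Y$ let $\mathrm{vec}(\mathbf Y)\in\mathbb R^{np}$ be the vector obtained by stacking its columns. For a positive definite matrix $\mathbf A$ let $\mathbf a=\mathrm{diag}(\sqrt{a_{11}},\sqrt{a_{22}},\dots)$ and let $\overline{\mathbf A}=\mathbf a^{-1}\mathbf A\,\mathbf a^{-1}$ be its correlation matrix. For positive definite $\mathbf V\in\mathbb R^{p\times p}$, $\boldsymbol\Sigma\in\mathbb R^{n\times n}$ and arbitrary $\mathbf M,\mathbf B\in\mathbb R^{n\times p}$, the matrix variate skew-normal distribution $SN_{n\times p}(\mathbf M,\mathbf V\otimes\boldsymbol\Sigma,\mathbf B)$ is the distribution on $\mathbb R^{n\times p}$ with Lebesgue density $$2\,\phi_{n\times p}(\mathbf Y;\mathbf M,\mathbf V\otimes\boldsymbol\Sigma)\,\Phi\big(\mathrm{vec}(\mathbf B)^T\boldsymbol\omega^{-1}\mathrm{vec}(\mathbf Y-\mathbf M)\big),\qquad \boldsymbol\omega=\mathbf v\otimes\boldsymbol\sigma,$$ where $\mathbf v$ and $\boldsymbol\sigma$ are the diagonal matrices of standard deviations of $\mathbf V$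 and $\boldsymbol\Sigma$, $\phi_{n\times p}(\cdot;\mathbf M,\mathbf V\otimes\boldsymbol\Sigma)$ is the matrix normal density with mean $\mathbf M$ and covariance matrix $\mathbf V\otimes\boldsymbol\Sigma$ of the vectorization, and $\Phi$ is the standard normal distribution function. Its parameter $\boldsymbol\delta\in\mathbb R^{np}$ is $$\boldsymbol\delta=\frac{(\mathbf V\otimes\boldsymbol\Sigma)\,\boldsymbol\omega^{-1}\mathrm{vec}(\mathbf B)}{\sqrt{1+\mathrm{vec}(\mathbf B)^T(\overline{\mathbf V}\otimes\overline{\boldsymbol\Sigma})\mathrm{vec}(\mathbf B)}}.$$ A function $f:\mathbb R^{n\times p}\to\mathbb R$ is supermodular if $\Delta^{\varepsilon}_{k,i}\Delta^{\eta}_{l,j}f(\mathbf X)\ge 0$ for all $\mathbf X$, all $\varepsilon,\eta>0$ and all positions $(k,i)\ne(l,j)$, where $\Delta^{\varepsilon}_{k,i}f(\mathbf X)=f(\mathbf X+\varepsilon\mathbf E_{k,i})-f(\mathbf X)$ and $\mathbf E_{k,i}$ is the matrix with entry $1$ at position $(k,i)$ and $0$ elsewhere. For random $n\times p$ matrices write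 $\boldsymbol X\le_{sm}\boldsymbol Y$ if $Ef(\boldsymbol X)\le Ef(\boldsymbol Y)$ for every measurable supermodular $f$ for which both expectations exist (are finite). **Theorem.** Let $\mathbf V,\mathbf V'\in\mathbb R^{p\times p}$ and $\boldsymbol\Sigma,\boldsymbol\Sigma'\in\mathbb R^{n\times n}$ be positive definite, $\mathbf B,\mathbf B'\in\mathbb R^{n\times p}$, and put $\overline{\boldsymbol\Omega}=\overline{\mathbf V}\otimes\overline{\boldsymbol\Sigma}=(\overline\omega_{rs})$, $\overline{\boldsymbol\Omega'}=\overline{\mathbf V'}\otimes\overline{\boldsymbol\Sigma'}=(\overline\omega'_{rs})$. Let $\boldsymbol X_0\sim SN_{n\times p}(\mathbf 0,\overline{\boldsymbol\Omega},\mathbf B)$ and $\boldsymbol Y_0\sim SN_{n\times p}(\mathbf 0,\overline{\boldsymbol\Omega'},\mathbf B')$ be standardized skew-normal random matrices, with parameters $\boldsymbol\delta$ and $\boldsymbol\delta'$ respectively. Then $$\boldsymbol X_0\le_{sm}\boldsymbol Y_0\iff \boldsymbol X_0\text{ and }\boldsymbol Y_0\text{ have the same marginals and }\overline\omega_{rs}\le\overline\omega'_{rs}\text{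 for all }r,s,$$ where having the same marginals means that for all $i,j$ the $(i,j)$ entries of $\boldsymbol X_0$ and $\boldsymbol Y_0$ have the same distribution. The same equivalence holds if in the definition of $\le_{sm}$ only twice differentiable supermodular functions $f$ are admitted. Moreover, if $\boldsymbol X_0$ and $\boldsymbol Y_0$ have the same marginals, then $\boldsymbol\delta=\boldsymbol\delta'$. -/

import Mathlib

open MeasureTheory ProbabilityTheory
open scoped Kronecker

noncomputable section

namespace SkewNormal

/-- The space of real `n × p` matrices, with its product `σ`-algebra, Lebesgue measure and
topology. -/
abbrev Mat (n p : ℕ) : Type := Fin n → Fin p → ℝ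

/-- Column-stacking vectorization; the entry `Y i j` has index `(j, i)`, which matches the index
convention of the Kronecker product `V ⊗ₖ S` of a `p × p` with an `n × n` matrix. -/
def vecM {n p : ℕ} (Y : Mat n p) : Fin p × Fin n → ℝ := Matrix.vec (Matrix.of Y)

/-- The diagonal matrix of standard deviations `diag (√A₁₁, …, √Aₘₘ)` of a covariance matrix. -/
def sdMatrix {m : ℕ} (A : Matrix (Fin m) (Fin m) ℝ) : Matrix (Fin m) (Fin m) ℝ :=
  Matrix.diagonal fun i => Real.sqrt (A i i)

/-- The correlation matrix `a⁻¹ A a⁻¹`, `a = sdMatrix A`, of a covariance matrix `A`. -/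
def corrMatrix {m : ℕ} (A : Matrix (Fin m) (Fin m) ℝ) : Matrix (Fin m) (Fin m) ℝ :=
  (sdMatrix A)⁻¹ * A * (sdMatrix A)⁻¹

/-- The density at `Y` of the matrix normal distribution with mean matrix `M` and covariance matrix
`V ⊗ S` of the vectorization. -/
def matrixNormalPDF {n p : ℕ} (M : Mat n p) (V : Matrix (Fin p) (Fin p) ℝ)
    (S : Matrix (Fin n) (Fin n) ℝ) (Y : Mat n p) : ℝ :=
  (Real.sqrt ((2 * Real.pi) ^ (n * p) * (V ⊗ₖ S).det))⁻¹ *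
    Real.exp (-(1 / 2) * (vecM (Y - M) ⬝ᵥ (V ⊗ₖ S)⁻¹.mulVec (vecM (Y - M))))

/-- The density of the matrix variate skew-normal distribution `SN (M, V ⊗ S, B)`:
`2 φ (Y; M, V ⊗ S) Φ (vec(B)ᵀ ω⁻¹ vec(Y - M))`, where `ω = v ⊗ σ`. -/
def matrixSkewNormalPDF {n p : ℕ} (M : Mat n p) (V : Matrix (Fin p) (Fin p) ℝ)
    (S : Matrix (Fin n) (Fin n) ℝ) (B : Mat n p) (Y : Mat n p) : ℝ :=
  2 * matrixNormalPDF M V S Y *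
    cdf (gaussianReal 0 1)
      (vecM B ⬝ᵥ (sdMatrix V ⊗ₖ sdMatrix S)⁻¹.mulVec (vecM (Y - M)))

/-- The matrix variate skew-normal distribution `SN (M, V ⊗ S, B)`. -/
def matrixSkewNormal {n p : ℕ} (M : Mat n p) (V : Matrix (Fin p) (Fin p) ℝ)
    (S : Matrix (Fin n) (Fin n) ℝ) (B : Mat n p) : Measure (Mat n p) :=
  volume.withDensity fun Y => ENNReal.ofReal (matrixSkewNormalPDF M V S B Y)

/-- The skewness parameter `δ = (V ⊗ S) ω⁻¹ vec(B) / √(1 + vec(B)ᵀ (corr V ⊗ corr S) vec(B))` of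
`SN (M, V ⊗ S, B)`, where `ω = v ⊗ σ`. -/
def skewDelta {n p : ℕ} (V : Matrix (Fin p) (Fin p) ℝ) (S : Matrix (Fin n) (Fin n) ℝ)
    (B : Mat n p) : Fin p × Fin n → ℝ :=
  (Real.sqrt (1 + vecM B ⬝ᵥ (corrMatrix V ⊗ₖ corrMatrix S).mulVec (vecM B)))⁻¹ •
    (V ⊗ₖ S).mulVec ((sdMatrix V ⊗ₖ sdMatrix S)⁻¹.mulVec (vecM B))

/-- The difference operator `f ↦ f (· + ε E_{i,j}) - f`. -/
def diffOp {n p : ℕ} (i : Fin n) (j : Fin p) (ε : ℝ) (f : Mat n p → ℝ) : Mat n p → ℝ :=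
  fun X => f (X + Pi.single i (Pi.single j ε)) - f X

/-- Supermodularity: the mixed second differences in any two distinct entries are nonnegative. -/
def IsSupermodular {n p : ℕ} (f : Mat n p → ℝ) : Prop :=
  ∀ (X : Mat n p) (k l : Fin n) (i j : Fin p), (k, i) ≠ (l, j) →
    ∀ ε δ : ℝ, 0 < ε → 0 < δ → 0 ≤ diffOp k i ε (diffOp l j δ f) X

/-- Twice (Fréchet) differentiable functions of a matrix. -/
def TwiceDifferentiable {n p : ℕ} (f : Mat n p → ℝ) : Prop :=
  Differentiable ℝ f ∧ Differentiable ℝ (fderiv ℝ f)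

/-- The integral stochastic order generated by a class `F` of functions: `E f(X) ≤ E f(Y)` for all
measurable `f ∈ F` for which both expectations exist. -/
def IntegralOrder {n p : ℕ} (F : Set (Mat n p → ℝ)) {Ω Ω' : Type*} [MeasurableSpace Ω]
    [MeasurableSpace Ω'] (P : Measure Ω) (P' : Measure Ω') (X : Ω → Mat n p) (Y : Ω' → Mat n p) :
    Prop :=
  ∀ f ∈ F, Measurable f → Integrable (fun w => f (X w)) P → Integrable (fun w => f (Y w)) P' →
    ∫ w, f (X w) ∂P ≤ ∫ w, f (Y w) ∂P'

/-- The supermodular order `X ≤_sm Y`. -/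
def SupermodularOrder {n p : ℕ} {Ω Ω' : Type*} [MeasurableSpace Ω] [MeasurableSpace Ω']
    (P : Measure Ω) (P' : Measure Ω') (X : Ω → Mat n p) (Y : Ω' → Mat n p) : Prop :=
  IntegralOrder {f | IsSupermodular f} P P' X Y

/-- The supermodular order tested on twice differentiable functions only. -/
def SmoothSupermodularOrder {n p : ℕ} {Ω Ω' : Type*} [MeasurableSpace Ω] [MeasurableSpace Ω']
    (P : Measure Ω) (P' : Measure Ω') (X : Ω → Mat n p) (Y : Ω' → Mat n p) : Prop :=
  IntegralOrder {f | IsSupermodular f ∧ TwiceDifferentiable f} P P' X Y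

/-- Equality of all one-dimensional marginal distributions, entry by entry. -/
def SameMarginals {n p : ℕ} {Ω Ω' : Type*} [MeasurableSpace Ω] [MeasurableSpace Ω']
    (P : Measure Ω) (P' : Measure Ω') (X : Ω → Mat n p) (Y : Ω' → Mat n p) : Prop :=
  ∀ (i : Fin n) (j : Fin p), IdentDistrib (fun w => X w i j) (fun w => Y w i j) P P'

end SkewNormal

end

noncomputable section

namespace SkewNormal

open Filter Topology
open scoped Convolution Matrix

/-! Sufficiency rests on a mixture representation. A standardized skew-normal vector with dispersion
`A` is distributed as `δ|U| + W`, with `U` standard normal and `W` an independent centred normal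
vector of covariance `A - δδᵀ` (`mixDensity_skewCov`, `integral_mul_skewDensity`). Means are a
universal multiple of `δ`, so equal marginals force equal `δ`. Conditionally on `|U| = u` both
vectors are then normal with the same shift `uδ`, and their covariances differ by `A' - A`, which is
entrywise nonnegative with zero diagonal. A translate of a supermodular function is supermodular, so
only the comparison of centred normal laws remains (`integral_mul_gaussDensity_le`).

That comparison interpolates the covariance along the segment from `A` to `B`. By the heat equation,
the derivative of the normal density in direction `D = B - A` is half the sum of `D r s` times its
mixed second derivatives. Paired with a supermodular `f` this is nonnegative: `f` has nonnegative
mixed derivatives in the sense of distributions (`integral_mul_mixed_deriv_nonneg`). Since `f` may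
fail to be integrable against the intermediate normal laws, the argument is run with compactly
supported elliptical kernels. They obey the same identity (`hasDerivAt_ellipticalDensity`), and the
cutoff is removed at the two endpoints by dominated convergence.

Necessity uses explicit smooth test functions. Cosines and sines of one entry are supermodular
together with their negatives, so the characteristic functions of the marginals agree. Products of
two entries are supermodular, and their expectations are the entries of the correlation matrix,
because the skewing factor does not affect integrals of even functions. Thus the smooth order
already implies the conditions that yield the full order. -/

theorem HasLineDerivAt.nonneg_of_le {E : Type*} [NormedAddCommGroup E] [NormedSpace ℝ E]
    {g : E → ℝ} {g' : ℝ} {x v : E}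
    (h : HasLineDerivAt ℝ g g' x v) (hle : ∀ t : ℝ, 0 < t → g x ≤ g (x + t • v)) : 0 ≤ g' := by
  have h1 := h.tendsto_slope_zero_right
  refine ge_of_tendsto h1 ?_
  filter_upwards [self_mem_nhdsWithin] with t ht
  have ht' : 0 < t := ht
  simp only [smul_eq_mul]
  exact mul_nonneg (by positivity) (sub_nonneg.2 (hle t ht'))

/-! ### Mixed second differences and distributional derivatives -/

section MixedDifference

variable {E : Type*} [NormedAddCommGroup E] [NormedSpace ℝ E] [FiniteDimensional ℝ E]
  [MeasurableSpace E] [BorelSpace E] {μ : Measure E} [μ.IsAddHaarMeasure]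

/-- The derivative of a convolution can be put on the smooth compactly supported factor, so `f` only
has to be locally integrable. -/
theorem hasLineDerivAt_convolution_right {f g g' : E → ℝ} {v : E}
    (hf : LocallyIntegrable f μ) (hg : ContDiff ℝ 1 g) (hc : HasCompactSupport g)
    (hg' : ∀ x, HasLineDerivAt ℝ g (g' x) x v) (x : E) :
    HasLineDerivAt ℝ (fun x => ∫ t, f t * g (x - t) ∂μ) (∫ t, f t * g' (x - t) ∂μ) x v := by
  have h := (hc.hasFDerivAt_convolution_right (ContinuousLinearMap.mul ℝ ℝ) hf hg x).hasLineDerivAt v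
  rw [convolution_precompR_apply _ hf (hc.fderiv ℝ) (hg.continuous_fderiv one_ne_zero)] at h
  convert! h using 1
  refine integral_congr_ae (Eventually.of_forall fun t => ?_)
  have := ((hg.differentiable one_ne_zero) (x - t)).lineDeriv_eq_fderiv (v := v)
  simp [← this, (hg' (x - t)).lineDeriv]

/-- A function whose mixed second differences in the directions `v`, `w` are nonnegative has a
nonnegative mixed second derivative in the sense of distributions. -/
theorem integral_mul_mixed_deriv_nonneg {f g g₁ g₂ : E → ℝ} {v w : E}
    (hf : LocallyIntegrable f μ)
    (hsm : ∀ (x : E) (ε δ : ℝ), 0 < ε → 0 < δ →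
      f (x + ε • v) + f (x + δ • w) ≤ f (x + ε • v + δ • w) + f x)
    (hg : ContDiff ℝ 1 g) (hc : HasCompactSupport g) (h0 : ∀ x, 0 ≤ g x)
    (hg₁ : ContDiff ℝ 1 g₁) (hc₁ : HasCompactSupport g₁)
    (hd₁ : ∀ x, HasLineDerivAt ℝ g (g₁ x) x w) (hd₂ : ∀ x, HasLineDerivAt ℝ g₁ (g₂ x) x v) :
    0 ≤ ∫ t, f t * g₂ (-t) ∂μ := by
  -- Mollification: `u` inherits the sign of the mixed differences of `f` because `g ≥ 0`, and the
  -- integral in question is the mixed derivative of `u` at the origin.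
  set u : E → ℝ := fun x => ∫ t, f t * g (x - t) ∂μ with hu
  have hint : ∀ x y : E, Integrable (fun t => f (x - t + y) * g t) μ := by
    intro x y
    have h1 : LocallyIntegrable (fun t => f (x - t + y)) μ := by
      intro z
      obtain ⟨s, hs, hi⟩ := hf (x - z + y)
      refine ⟨(fun t => x - t + y) ⁻¹' s, ?_, ?_⟩
      · exact ContinuousAt.preimage_mem_nhds (by fun_prop) hs
      · have hmp : MeasurePreserving (fun t => x - t + y) μ μ :=
          (measurePreserving_add_right μ y).comp (Measure.measurePreserving_sub_left μ x)
        have he : MeasurableEmbedding (fun t => x - t + y) :=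
          ((Homeomorph.subLeft x).trans (Homeomorph.addRight y)).measurableEmbedding
        exact (hmp.integrableOn_comp_preimage he).2 hi
    exact (h1.integrable_smul_right_of_hasCompactSupport hg.continuous hc)
  have hu' : ∀ x y : E, u (x + y) = ∫ t, f (x - t + y) * g t ∂μ := by
    intro x y
    rw [hu]
    simp only
    rw [← integral_sub_left_eq_self _ μ (x + y)]
    refine integral_congr_ae (Eventually.of_forall fun t => ?_)
    simp only [sub_sub_cancel]
    congr 2
    abel
  have hdu : ∀ x, HasLineDerivAt ℝ u (∫ t, f t * g₁ (x - t) ∂μ) x w :=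
    hasLineDerivAt_convolution_right hf hg hc hd₁
  have hdu₁ := hasLineDerivAt_convolution_right hf hg₁ hc₁ hd₂ (0 : E)
  simp only [zero_sub] at hdu₁
  -- Derivatives are traded for differences one direction at a time: here along `v`, and below along
  -- `w` for the increment `u (· + ε v) - u`.
  refine HasLineDerivAt.nonneg_of_le hdu₁ fun ε hε => ?_
  have h2 : HasLineDerivAt ℝ (fun x => u (x + ε • v) - u x)
      ((∫ t, f t * g₁ (0 + ε • v - t) ∂μ) - ∫ t, f t * g₁ (0 - t) ∂μ) 0 w := by
    have h3 : HasLineDerivAt ℝ (fun x => u (x + ε • v)) (∫ t, f t * g₁ (0 + ε • v - t) ∂μ) 0 w := by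
      have := hdu (0 + ε • v)
      unfold HasLineDerivAt at this ⊢
      simpa only [add_right_comm] using this
    exact HasDerivAt.sub h3 (hdu 0)
  rw [← sub_nonneg]
  refine HasLineDerivAt.nonneg_of_le h2 fun δ hδ => ?_
  have e1 := hu' 0 (ε • v)
  have e2 := hu' 0 (δ • w)
  have e3 := hu' 0 (δ • w + ε • v)
  have e4 := hu' 0 0
  rw [add_zero] at e4
  rw [← add_assoc] at e3
  rw [e1, e2, e3, e4, ← integral_sub (hint _ _) (hint _ _), ← integral_sub (hint _ _) (hint _ _)]
  refine integral_mono ((hint _ _).sub (hint _ _)) ((hint _ _).sub (hint _ _)) fun t => ?_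
  have := hsm (0 - t) ε δ hε hδ
  have h5 : 0 - t + (δ • w + ε • v) = 0 - t + ε • v + δ • w := by abel
  simp only [h5, add_zero]
  nlinarith [h0 t]

end MixedDifference

/-! ### Quadratic forms and elliptical test functions -/

section

variable {ι : Type*} [Fintype ι]

theorem contDiff_quadForm (P : Matrix ι ι ℝ) {n : WithTop ℕ∞} :
    ContDiff ℝ n fun x : ι → ℝ => x ⬝ᵥ P *ᵥ x := by
  simp only [dotProduct, Matrix.mulVec]
  fun_prop

theorem contDiff_dotProduct_mulVec (P : Matrix ι ι ℝ) (v : ι → ℝ) {n : WithTop ℕ∞} :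
    ContDiff ℝ n fun x : ι → ℝ => v ⬝ᵥ P *ᵥ x := by
  simp only [dotProduct, Matrix.mulVec]
  fun_prop

theorem dotProduct_mulVec_comm_of_isSymm {P : Matrix ι ι ℝ} (hP : P.IsSymm) (x y : ι → ℝ) :
    x ⬝ᵥ P *ᵥ y = y ⬝ᵥ P *ᵥ x := by
  rw [Matrix.dotProduct_mulVec, ← Matrix.mulVec_transpose, hP.eq, dotProduct_comm]

theorem hasLineDerivAt_quadForm {P : Matrix ι ι ℝ} (hP : P.IsSymm) (x v : ι → ℝ) :
    HasLineDerivAt ℝ (fun x => x ⬝ᵥ P *ᵥ x) (2 * (v ⬝ᵥ P *ᵥ x)) x v := by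
  have h : (fun t : ℝ => (x + t • v) ⬝ᵥ P *ᵥ (x + t • v)) =
      fun t => x ⬝ᵥ P *ᵥ x + t * (2 * (v ⬝ᵥ P *ᵥ x)) + t ^ 2 * (v ⬝ᵥ P *ᵥ v) := by
    funext t
    have := dotProduct_mulVec_comm_of_isSymm hP x v
    simp only [Matrix.mulVec_add, Matrix.mulVec_smul, add_dotProduct, dotProduct_add,
      smul_dotProduct, dotProduct_smul, smul_eq_mul]
    rw [this]; ring
  unfold HasLineDerivAt
  rw [h]
  have h1 := (((hasDerivAt_id (0 : ℝ)).mul_const (2 * (v ⬝ᵥ P *ᵥ x))).const_add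
    (x ⬝ᵥ P *ᵥ x)).add (((hasDerivAt_id (0 : ℝ)).pow 2).mul_const (v ⬝ᵥ P *ᵥ v))
  convert! h1 using 1
  simp

theorem hasLineDerivAt_dotProduct_mulVec (P : Matrix ι ι ℝ) (w x v : ι → ℝ) :
    HasLineDerivAt ℝ (fun x => w ⬝ᵥ P *ᵥ x) (w ⬝ᵥ P *ᵥ v) x v := by
  have h : (fun t : ℝ => w ⬝ᵥ P *ᵥ (x + t • v)) =
      fun t => w ⬝ᵥ P *ᵥ x + t * (w ⬝ᵥ P *ᵥ v) := by
    funext t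
    simp only [Matrix.mulVec_add, Matrix.mulVec_smul, dotProduct_add, dotProduct_smul, smul_eq_mul]
  unfold HasLineDerivAt
  rw [h]
  simpa using ((hasDerivAt_id (0 : ℝ)).mul_const (w ⬝ᵥ P *ᵥ v)).const_add (w ⬝ᵥ P *ᵥ x)

theorem HasLineDerivAt.comp_deriv {E : Type*} [NormedAddCommGroup E] [NormedSpace ℝ E]
    {G : ℝ → ℝ} {q : E → ℝ} {q' : ℝ} {x v : E} (hG : Differentiable ℝ G)
    (hq : HasLineDerivAt ℝ q q' x v) :
    HasLineDerivAt ℝ (fun x => G (q x)) (deriv G (q x) * q') x v := by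
  have h1 : HasDerivAt G (deriv G (q x)) (q (x + (0 : ℝ) • v)) := by
    simpa using (hG (q x)).hasDerivAt
  exact h1.comp (0 : ℝ) hq

theorem HasLineDerivAt.mul' {E : Type*} [NormedAddCommGroup E] [NormedSpace ℝ E]
    {g h : E → ℝ} {g' h' : ℝ} {x v : E} (hg : HasLineDerivAt ℝ g g' x v)
    (hh : HasLineDerivAt ℝ h h' x v) :
    HasLineDerivAt ℝ (fun x => g x * h x) (g' * h x + g x * h') x v := by
  have h := HasDerivAt.mul (𝔸 := ℝ) hg hh
  simp only [zero_smul, add_zero] at h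
  exact h

theorem _root_.Matrix.PosDef.isSymm {ι : Type*} {A : Matrix ι ι ℝ} (hA : A.PosDef) : A.IsSymm := by
  have := hA.isHermitian
  rwa [Matrix.IsHermitian, Matrix.conjTranspose_eq_transpose_of_trivial] at this

theorem _root_.Matrix.PosDef.dotProduct_mulVec_self_nonneg {A : Matrix ι ι ℝ} (hA : A.PosDef)
    (x : ι → ℝ) : 0 ≤ x ⬝ᵥ A *ᵥ x := by
  simpa using hA.posSemidef.dotProduct_mulVec_nonneg x

section PosDef

variable [DecidableEq ι]

theorem _root_.Matrix.PosDef.mulVec_inv_mulVec {A : Matrix ι ι ℝ} (hA : A.PosDef) (x : ι → ℝ) :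
    A *ᵥ (A⁻¹ *ᵥ x) = x := by
  rw [Matrix.mulVec_mulVec, Matrix.mul_nonsing_inv _ (hA.det_pos.ne'.isUnit), Matrix.one_mulVec]

/-- Cauchy–Schwarz for the inner product of `A`, applied to `A⁻¹ x` and a basis vector. The bound
involves `A` only through its diagonal, which stays fixed along the later interpolation. -/
theorem _root_.Matrix.PosDef.sq_apply_le {A : Matrix ι ι ℝ} (hA : A.PosDef) (x : ι → ℝ) (i : ι) :
    x i ^ 2 ≤ A i i * (x ⬝ᵥ A⁻¹ *ᵥ x) := by
  set y := A⁻¹ *ᵥ x with hy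
  have hx : A *ᵥ y = x := hA.mulVec_inv_mulVec x
  have hd : 0 < A i i := hA.diag_pos
  have key : ∀ s : ℝ, 0 ≤ x ⬝ᵥ y - 2 * s * x i + s ^ 2 * A i i := by
    intro s
    have h := hA.dotProduct_mulVec_self_nonneg (y - s • Pi.single i 1)
    have hc := dotProduct_mulVec_comm_of_isSymm hA.isSymm y (Pi.single i 1)
    simp only [Matrix.mulVec_sub, Matrix.mulVec_smul, sub_dotProduct, dotProduct_sub,
      smul_dotProduct, dotProduct_smul, smul_eq_mul, hc, hx] at h
    simp only [single_one_dotProduct, Matrix.mulVec_single_one, Matrix.col_apply] at h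
    rw [dotProduct_comm] at h
    nlinarith
  -- The value of `s` that minimizes the quadratic in `key`.
  have := key (x i / A i i)
  have h2 : x ⬝ᵥ y - 2 * (x i / A i i) * x i + (x i / A i i) ^ 2 * A i i =
      x ⬝ᵥ y - x i ^ 2 / A i i := by field_simp; ring
  rw [h2, sub_nonneg, div_le_iff₀ hd] at this
  linarith

theorem _root_.Matrix.PosDef.norm_le_of_quadForm_le {A : Matrix ι ι ℝ} (hA : A.PosDef) {M R : ℝ}
    (hM : ∀ i, A i i ≤ M) (x : ι → ℝ) (hx : x ⬝ᵥ A⁻¹ *ᵥ x ≤ R) : ‖x‖ ≤ √(M * R) := by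
  refine (pi_norm_le_iff_of_nonneg (Real.sqrt_nonneg _)).2 fun i => ?_
  have h0 := hA.inv.dotProduct_mulVec_self_nonneg x
  rw [Real.norm_eq_abs]
  refine Real.abs_le_sqrt ((hA.sq_apply_le x i).trans ?_)
  have := (hA.diag_pos (i := i)).le
  exact mul_le_mul (hM i) hx h0 (this.trans (hM i))

theorem hasCompactSupport_comp_quadForm {A : Matrix ι ι ℝ} (hA : A.PosDef) {F : (ι → ℝ) → ℝ}
    {R : ℝ} (hF : ∀ x, R < x ⬝ᵥ A⁻¹ *ᵥ x → F x = 0) : HasCompactSupport F := by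
  refine HasCompactSupport.intro (isCompact_closedBall (0 : ι → ℝ) (√((∑ i, A i i) * R)))
    fun x hx => hF x ?_
  by_contra h
  rw [not_lt] at h
  refine hx ?_
  rw [mem_closedBall_zero_iff]
  exact hA.norm_le_of_quadForm_le
    (fun i => Finset.single_le_sum (f := fun i => A i i) (fun j _ => hA.diag_pos.le) (Finset.mem_univ i)) x h

theorem deriv_eq_zero_of_eq_zero_of_lt {G : ℝ → ℝ} {R : ℝ} (hG : ∀ v, R < v → G v = 0) (v : ℝ)
    (hv : R < v) : deriv G v = 0 := by
  have : G =ᶠ[𝓝 v] fun _ => 0 := by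
    filter_upwards [lt_mem_nhds hv] with w hw using hG w hw
  rw [this.deriv_eq, deriv_const]

theorem contDiff_deriv_of_three {G : ℝ → ℝ} (hG : ContDiff ℝ 3 G) : ContDiff ℝ 2 (deriv G) := by
  have : ContDiff ℝ (2 + 1) G := hG
  exact (contDiff_succ_iff_deriv.1 this).2.2

/-- The bracket is half the mixed derivative of `G (xᵀ A⁻¹ x)` along `v` and `w`. It is even in `x`,
so the reflection in `integral_mul_mixed_deriv_nonneg` is harmless. -/
theorem integral_mul_elliptical_mixed_nonneg {A : Matrix ι ι ℝ} (hA : A.PosDef)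
    {f : (ι → ℝ) → ℝ} (hf : LocallyIntegrable f) {v w : ι → ℝ}
    (hsm : ∀ (x : ι → ℝ) (ε δ : ℝ), 0 < ε → 0 < δ →
      f (x + ε • v) + f (x + δ • w) ≤ f (x + ε • v + δ • w) + f x)
    {G : ℝ → ℝ} (hG : ContDiff ℝ 3 G) (h0 : ∀ v, 0 ≤ G v) {R : ℝ} (hR : ∀ v, R < v → G v = 0) :
    0 ≤ ∫ x, f x * (2 * deriv (deriv G) (x ⬝ᵥ A⁻¹ *ᵥ x) * ((v ⬝ᵥ A⁻¹ *ᵥ x) * (w ⬝ᵥ A⁻¹ *ᵥ x)) +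
      deriv G (x ⬝ᵥ A⁻¹ *ᵥ x) * (w ⬝ᵥ A⁻¹ *ᵥ v)) := by
  have hs : (A⁻¹).IsSymm := hA.inv.isSymm
  have hG' : ContDiff ℝ 2 (deriv G) := contDiff_deriv_of_three hG
  have key := integral_mul_mixed_deriv_nonneg (μ := volume) (f := f) (v := v) (w := w)
    (g := fun x => G (x ⬝ᵥ A⁻¹ *ᵥ x))
    (g₁ := fun x => deriv G (x ⬝ᵥ A⁻¹ *ᵥ x) * (2 * (w ⬝ᵥ A⁻¹ *ᵥ x)))
    (g₂ := fun x => deriv (deriv G) (x ⬝ᵥ A⁻¹ *ᵥ x) * (2 * (v ⬝ᵥ A⁻¹ *ᵥ x)) *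
      (2 * (w ⬝ᵥ A⁻¹ *ᵥ x)) + deriv G (x ⬝ᵥ A⁻¹ *ᵥ x) * (2 * (w ⬝ᵥ A⁻¹ *ᵥ v)))
    hf hsm ((hG.of_le (by norm_num)).comp (contDiff_quadForm _))
    (hasCompactSupport_comp_quadForm hA fun x hx => hR _ hx) (fun x => h0 _)
    (((hG'.of_le (by norm_num)).comp (contDiff_quadForm _)).mul
      (contDiff_const.mul (contDiff_dotProduct_mulVec _ _)))
    (hasCompactSupport_comp_quadForm (R := R) hA fun x hx => by
      rw [deriv_eq_zero_of_eq_zero_of_lt hR _ hx, zero_mul])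
    (fun x => HasLineDerivAt.comp_deriv (hG.differentiable (by norm_num))
      (hasLineDerivAt_quadForm hs x w))
    (fun x => ?_)
  · have h2 : ∀ x : ι → ℝ, f x * (2 * deriv (deriv G) (x ⬝ᵥ A⁻¹ *ᵥ x) *
        ((v ⬝ᵥ A⁻¹ *ᵥ x) * (w ⬝ᵥ A⁻¹ *ᵥ x)) + deriv G (x ⬝ᵥ A⁻¹ *ᵥ x) * (w ⬝ᵥ A⁻¹ *ᵥ v)) =
        (1 / 2) * (f x * (deriv (deriv G) (-x ⬝ᵥ A⁻¹ *ᵥ -x) * (2 * (v ⬝ᵥ A⁻¹ *ᵥ -x)) *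
      (2 * (w ⬝ᵥ A⁻¹ *ᵥ -x)) + deriv G (-x ⬝ᵥ A⁻¹ *ᵥ -x) * (2 * (w ⬝ᵥ A⁻¹ *ᵥ v)))) := by
      intro x
      simp only [Matrix.mulVec_neg, dotProduct_neg, neg_dotProduct, neg_neg]
      ring
    simp only [h2]
    rw [integral_const_mul]
    positivity
  · refine (HasLineDerivAt.mul' (HasLineDerivAt.comp_deriv (hG'.differentiable (by norm_num))
      (hasLineDerivAt_quadForm hs x v)) (HasLineDerivAt.mul' (g := fun _ => 2) (g' := 0) ?_
        (hasLineDerivAt_dotProduct_mulVec _ w x v))).congr_deriv ?_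
    · simpa [HasLineDerivAt] using hasDerivAt_const (0 : ℝ) (2 : ℝ)
    · ring

end PosDef

end

/-! ### Determinant and inverse along a line of matrices -/

section

variable {ι : Type*} [Fintype ι] [DecidableEq ι]

theorem continuousOn_matrix_inv {X : Type*} [TopologicalSpace X] {M : X → Matrix ι ι ℝ} {s : Set X}
    (hM : ContinuousOn M s) (hdet : ∀ t ∈ s, (M t).det ≠ 0) :
    ContinuousOn (fun t => (M t)⁻¹) s := by
  simp only [Matrix.inv_def, Ring.inverse_eq_inv']
  have h1 : Continuous fun A : Matrix ι ι ℝ => A.det := Continuous.matrix_det continuous_id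
  have h2 : Continuous fun A : Matrix ι ι ℝ => A.adjugate := Continuous.matrix_adjugate continuous_id
  exact ((h1.comp_continuousOn hM).inv₀ hdet).smul (h2.comp_continuousOn hM)

/-- Jacobi's formula. After factoring out the matrix `M` at time `t`, what is left is a polynomial
in `s - t` whose linear coefficient is the trace of `M⁻¹ D`. -/
theorem hasDerivAt_det_add_smul (A D : Matrix ι ι ℝ) {t : ℝ} (h : (A + t • D).det ≠ 0) :
    HasDerivAt (fun s : ℝ => (A + s • D).det)
      ((A + t • D).det * ((A + t • D)⁻¹ * D).trace) t := by
  set M := A + t • D with hM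
  have h1 : (fun s : ℝ => (A + s • D).det) = fun s : ℝ => M.det *
      (Polynomial.eval (s - t) (1 + (Polynomial.X : Polynomial ℝ) • (M⁻¹ * D).map Polynomial.C).det)
      := by
    funext s
    have h2 : A + s • D = M * (1 + (s - t) • (M⁻¹ * D)) := by
      rw [mul_add, mul_one, Matrix.mul_smul, ← mul_assoc, Matrix.mul_nonsing_inv _ h.isUnit,
        one_mul, hM, sub_smul]
      abel
    rw [h2, Matrix.det_mul]
    congr 1
    rw [← Polynomial.coe_evalRingHom, RingHom.map_det]
    congr 1
    ext i j
    by_cases hij : i = j <;> simp [hij, -Matrix.map_mul, mul_comm (s - t)]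
  rw [h1]
  have h3 := HasDerivAt.comp (h := fun s : ℝ => s - t) t
    ((1 + (Polynomial.X : Polynomial ℝ) • (M⁻¹ * D).map Polynomial.C).det.hasDerivAt (t - t))
    ((hasDerivAt_id t).sub_const t)
  rw [sub_self, Matrix.derivative_det_one_add_X_smul, mul_one] at h3
  exact h3.const_mul _

/-- The resolvent identity makes the difference quotient an exact expression in the two inverses, so
continuity of inversion suffices to pass to the limit. -/
theorem hasDerivAt_quadForm_inv_add_smul (A D : Matrix ι ι ℝ) {t : ℝ}
    (h : (A + t • D).det ≠ 0) (hs : ∀ s : ℝ, ((A + s • D)⁻¹).IsSymm) (x : ι → ℝ) :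
    HasDerivAt (fun s : ℝ => x ⬝ᵥ (A + s • D)⁻¹ *ᵥ x)
      (-(((A + t • D)⁻¹ *ᵥ x) ⬝ᵥ D *ᵥ ((A + t • D)⁻¹ *ᵥ x))) t := by
  have hc : Continuous fun s : ℝ => A + s • D := by fun_prop
  have hdet : ∀ᶠ s in 𝓝 t, (A + s • D).det ≠ 0 :=
    (Continuous.matrix_det hc).continuousAt.eventually_ne h
  have hinv : ContinuousAt (fun s : ℝ => (A + s • D)⁻¹) t :=
    (continuousOn_matrix_inv hc.continuousOn (s := {s | (A + s • D).det ≠ 0})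
      fun s hs => hs).continuousAt hdet
  rw [hasDerivAt_iff_tendsto_slope]
  have hcont : ContinuousAt (fun s : ℝ =>
      -(((A + s • D)⁻¹ *ᵥ x) ⬝ᵥ D *ᵥ ((A + t • D)⁻¹ *ᵥ x))) t := by
    have h1 : Continuous fun N : Matrix ι ι ℝ => -((N *ᵥ x) ⬝ᵥ D *ᵥ ((A + t • D)⁻¹ *ᵥ x)) :=
      ((Continuous.matrix_mulVec continuous_id continuous_const).dotProduct continuous_const).neg
    exact h1.continuousAt.comp hinv
  refine (hcont.tendsto.mono_left nhdsWithin_le_nhds).congr' ?_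
  filter_upwards [hdet.filter_mono nhdsWithin_le_nhds, self_mem_nhdsWithin] with s hds hst
  have hst' : s - t ≠ 0 := sub_ne_zero.2 hst
  have key : (A + s • D)⁻¹ - (A + t • D)⁻¹ =
      -((s - t) • ((A + s • D)⁻¹ * D * (A + t • D)⁻¹)) := by
    have e : (s - t) • D = (A + s • D) - (A + t • D) := by rw [sub_smul]; abel
    rw [← Matrix.smul_mul, ← Matrix.mul_smul, e, mul_sub, sub_mul,
      Matrix.nonsing_inv_mul _ hds.isUnit, one_mul, mul_assoc, Matrix.mul_nonsing_inv _ h.isUnit,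
      mul_one]
    abel
  rw [slope_def_field, eq_div_iff hst', ← dotProduct_sub, ← Matrix.sub_mulVec, key,
    Matrix.neg_mulVec, Matrix.smul_mulVec, dotProduct_neg, dotProduct_smul,
    mul_assoc, ← Matrix.mulVec_mulVec, ← Matrix.mulVec_mulVec,
    dotProduct_mulVec_comm_of_isSymm (hs s) x, dotProduct_comm]
  simp only [smul_eq_mul]
  ring

end

/-! ### Monotonicity of elliptical integrals in the dispersion matrix -/

section

theorem _root_.Matrix.PosDef.add_smul_sub {ι : Type*} {A B : Matrix ι ι ℝ} (hA : A.PosDef) (hB : B.PosDef)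
    {t : ℝ} (ht : t ∈ Set.Icc (0 : ℝ) 1) : (A + t • (B - A)).PosDef := by
  have e : A + t • (B - A) = (1 - t) • A + t • B := by
    rw [smul_sub, sub_smul, one_smul]; abel
  rw [e]
  rcases ht.1.eq_or_lt with h | h
  · simpa [← h] using hA
  · exact Matrix.PosDef.posSemidef_add (hA.posSemidef.smul (sub_nonneg.2 ht.2)) (hB.smul h)

variable {ι : Type*} [Fintype ι] [DecidableEq ι]

/-- The density with generator `-2 G'` of an elliptical distribution with dispersion matrix `A`. -/
def ellipticalDensity (G : ℝ → ℝ) (A : Matrix ι ι ℝ) (x : ι → ℝ) : ℝ :=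
  -2 * (√A.det)⁻¹ * deriv G (x ⬝ᵥ A⁻¹ *ᵥ x)

/-- The derivative of `ellipticalDensity G` at `A` in the direction `D`. -/
def ellipticalDensityDeriv (G : ℝ → ℝ) (A D : Matrix ι ι ℝ) (x : ι → ℝ) : ℝ :=
  (√A.det)⁻¹ * ∑ r, ∑ s, D r s * (2 * deriv (deriv G) (x ⬝ᵥ A⁻¹ *ᵥ x) *
    ((Pi.single r 1 ⬝ᵥ A⁻¹ *ᵥ x) * (Pi.single s 1 ⬝ᵥ A⁻¹ *ᵥ x)) +
      deriv G (x ⬝ᵥ A⁻¹ *ᵥ x) * (Pi.single s 1 ⬝ᵥ A⁻¹ *ᵥ Pi.single r 1))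

theorem contDiff_deriv_of_two {G : ℝ → ℝ} (hG : ContDiff ℝ 2 G) : ContDiff ℝ 1 (deriv G) := by
  have : ContDiff ℝ (1 + 1) G := hG
  exact (contDiff_succ_iff_deriv.1 this).2.2

/-- The analogue of the heat equation: the determinant contributes the `deriv G` term and the
inverse the second-derivative term. Together they form half the `D`-weighted sum of mixed second
derivatives of `(det)^(-1/2) G (xᵀ A⁻¹ x)`. The generator `-2 G'` is chosen so that this holds. -/
theorem hasDerivAt_ellipticalDensity {G : ℝ → ℝ} (hG : ContDiff ℝ 3 G) {A D : Matrix ι ι ℝ}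
    (hA : A.IsSymm) (hD : D.IsSymm) {t : ℝ} (ht : (A + t • D).PosDef) (x : ι → ℝ) :
    HasDerivAt (fun s : ℝ => ellipticalDensity G (A + s • D) x)
      (ellipticalDensityDeriv G (A + t • D) D x) t := by
  have hdet := ht.det_pos
  have hs : ∀ s : ℝ, ((A + s • D)⁻¹).IsSymm := fun s => by
    rw [Matrix.IsSymm, Matrix.transpose_nonsing_inv, Matrix.transpose_add, Matrix.transpose_smul,
      hA.eq, hD.eq]
  have h1 := hasDerivAt_det_add_smul A D hdet.ne'
  have h2 := hasDerivAt_quadForm_inv_add_smul A D hdet.ne' hs x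
  have h3 := (h1.sqrt hdet.ne').inv (Real.sqrt_ne_zero'.2 hdet)
  have h4 : HasDerivAt (deriv G) (deriv (deriv G) (x ⬝ᵥ (A + t • D)⁻¹ *ᵥ x))
      (x ⬝ᵥ (A + t • D)⁻¹ *ᵥ x) :=
    ((contDiff_deriv_of_three hG).differentiable (by norm_num) _).hasDerivAt
  have h5 := h4.comp t h2
  have h6 := (h3.const_mul (-2)).mul h5
  refine h6.congr_deriv ?_
  simp only [ellipticalDensityDeriv, Function.comp]
  set P := (A + t • D)⁻¹ with hP
  set y := P *ᵥ x with hy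
  have hsq : √(A + t • D).det ^ 2 = (A + t • D).det := Real.sq_sqrt hdet.le
  have hne : √(A + t • D).det ≠ 0 := Real.sqrt_ne_zero'.2 hdet
  have e1 : y ⬝ᵥ D *ᵥ y = ∑ r, ∑ s, D r s * (y r * y s) := by
    simp only [dotProduct, Matrix.mulVec, Finset.mul_sum]
    exact Finset.sum_congr rfl fun r _ => Finset.sum_congr rfl fun s _ => by ring
  have e2 : (P * D).trace = ∑ r, ∑ s, D r s * P s r := by
    simp only [Matrix.trace, Matrix.diag, Matrix.mul_apply]
    rw [Finset.sum_comm]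
    exact Finset.sum_congr rfl fun r _ => Finset.sum_congr rfl fun s _ => by ring
  simp only [single_one_dotProduct, Matrix.mulVec_single_one, Matrix.col_apply]
  have e3 : ∑ r, ∑ s, D r s * (2 * deriv (deriv G) (x ⬝ᵥ y) * (y r * y s) +
      deriv G (x ⬝ᵥ y) * P s r) = 2 * deriv (deriv G) (x ⬝ᵥ y) * (y ⬝ᵥ D *ᵥ y) +
      deriv G (x ⬝ᵥ y) * (P * D).trace := by
    rw [e1, e2]
    simp only [Finset.mul_sum, mul_add, Finset.sum_add_distrib]
    congr 1 <;>
    exact Finset.sum_congr rfl fun r _ => Finset.sum_congr rfl fun s _ => by ring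
  rw [e3]
  simp only [Pi.inv_apply]
  rw [hsq]
  field_simp
  ring

/-- The vanishing diagonal of `D` is essential: supermodularity controls only pairs of distinct
coordinates and says nothing about pure second derivatives. -/
theorem integral_mul_ellipticalDensityDeriv_nonneg {A D : Matrix ι ι ℝ} (hA : A.PosDef)
    (hD : ∀ i j, 0 ≤ D i j) (hD0 : ∀ i, D i i = 0) {f : (ι → ℝ) → ℝ} (hf : LocallyIntegrable f)
    (hsm : ∀ (x : ι → ℝ) (r s : ι) (ε δ : ℝ), r ≠ s → 0 < ε → 0 < δ →
      f (x + Pi.single r ε) + f (x + Pi.single s δ) ≤ f (x + Pi.single r ε + Pi.single s δ) + f x)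
    {G : ℝ → ℝ} (hG : ContDiff ℝ 3 G) (h0 : ∀ v, 0 ≤ G v) {R : ℝ} (hR : ∀ v, R < v → G v = 0) :
    0 ≤ ∫ x, f x * ellipticalDensityDeriv G A D x := by
  have hG1 := contDiff_deriv_of_three hG
  have hG2 := contDiff_deriv_of_two hG1
  have hR1 := deriv_eq_zero_of_eq_zero_of_lt hR
  have hR2 := deriv_eq_zero_of_eq_zero_of_lt hR1
  have hi : ∀ r s : ι, Integrable fun x => f x *
      (2 * deriv (deriv G) (x ⬝ᵥ A⁻¹ *ᵥ x) *
      ((Pi.single r 1 ⬝ᵥ A⁻¹ *ᵥ x) * (Pi.single s 1 ⬝ᵥ A⁻¹ *ᵥ x)) +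
        deriv G (x ⬝ᵥ A⁻¹ *ᵥ x) * (Pi.single s 1 ⬝ᵥ A⁻¹ *ᵥ Pi.single r 1)) := fun r s => by
    refine hf.integrable_smul_right_of_hasCompactSupport ?_ ?_
    · have := (contDiff_quadForm (n := 0) A⁻¹).continuous
      have h1 := hG1.continuous.comp this
      have h2 := hG2.continuous.comp this
      have h3 := fun v => (contDiff_dotProduct_mulVec (n := 0) A⁻¹ v).continuous
      exact ((continuous_const.mul h2).mul ((h3 _).mul (h3 _))).add (h1.mul continuous_const)
    · refine hasCompactSupport_comp_quadForm (R := R) hA fun x hx => ?_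
      rw [hR1 _ hx, hR2 _ hx]; ring
  have e : ∀ x, f x * ellipticalDensityDeriv G A D x = ∑ r, ∑ s, ((√A.det)⁻¹ * D r s) *
      (f x * (2 * deriv (deriv G) (x ⬝ᵥ A⁻¹ *ᵥ x) *
      ((Pi.single r 1 ⬝ᵥ A⁻¹ *ᵥ x) * (Pi.single s 1 ⬝ᵥ A⁻¹ *ᵥ x)) +
        deriv G (x ⬝ᵥ A⁻¹ *ᵥ x) * (Pi.single s 1 ⬝ᵥ A⁻¹ *ᵥ Pi.single r 1))) := fun x => by
    simp only [ellipticalDensityDeriv, Finset.mul_sum]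
    exact Finset.sum_congr rfl fun r _ => Finset.sum_congr rfl fun s _ => by ring
  simp only [e]
  rw [integral_finsetSum _ fun r _ => integrable_finsetSum _ fun s _ => (hi r s).const_mul _]
  refine Finset.sum_nonneg fun r _ => ?_
  rw [integral_finsetSum _ fun s _ => (hi r s).const_mul _]
  refine Finset.sum_nonneg fun s _ => ?_
  rw [integral_const_mul]
  rcases eq_or_ne r s with rfl | hrs
  · simp [hD0]
  · refine mul_nonneg (mul_nonneg (by positivity) (hD r s)) ?_
    refine integral_mul_elliptical_mixed_nonneg hA hf ?_ hG h0 hR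
    intro x ε δ hε hδ
    simpa [← Pi.single_smul'] using hsm x r s ε δ hrs hε hδ

theorem continuousOn_inv_posDef :
    ContinuousOn (fun p : Matrix ι ι ℝ × (ι → ℝ) => p.1⁻¹) {p | p.1.PosDef} :=
  continuousOn_matrix_inv continuousOn_fst fun _ hp => Matrix.PosDef.det_pos hp |>.ne'

theorem continuousOn_quadForm_inv_posDef :
    ContinuousOn (fun p : Matrix ι ι ℝ × (ι → ℝ) => p.2 ⬝ᵥ p.1⁻¹ *ᵥ p.2) {p | p.1.PosDef} := by
  have h1 : Continuous fun p : Matrix ι ι ℝ × (ι → ℝ) => p.2 ⬝ᵥ p.1 *ᵥ p.2 :=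
    continuous_snd.dotProduct (continuous_fst.matrix_mulVec continuous_snd)
  exact h1.comp_continuousOn (continuousOn_inv_posDef.prodMk continuousOn_snd)

theorem continuousOn_inv_sqrt_det_posDef :
    ContinuousOn (fun p : Matrix ι ι ℝ × (ι → ℝ) => (√p.1.det)⁻¹) {p | p.1.PosDef} := by
  refine ContinuousOn.inv₀ (Continuous.continuousOn ?_) fun p hp =>
    Real.sqrt_ne_zero'.2 (Matrix.PosDef.det_pos hp)
  exact (Continuous.matrix_det continuous_fst).sqrt

theorem continuousOn_ellipticalDensity {G : ℝ → ℝ} (hG : Continuous (deriv G)) :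
    ContinuousOn (fun p : Matrix ι ι ℝ × (ι → ℝ) => ellipticalDensity G p.1 p.2)
      {p | p.1.PosDef} :=
  (continuousOn_const.mul continuousOn_inv_sqrt_det_posDef).mul
    (hG.comp_continuousOn continuousOn_quadForm_inv_posDef)

theorem continuous_dotProduct_mulVec_left {ι : Type*} [Fintype ι] (v : ι → ℝ) :
    Continuous fun p : Matrix ι ι ℝ × (ι → ℝ) => v ⬝ᵥ p.1 *ᵥ p.2 :=
  continuous_const.dotProduct (continuous_fst.matrix_mulVec continuous_snd)

theorem continuousOn_dotProduct_inv_mulVec (v : ι → ℝ) {g : (ι → ℝ) → ι → ℝ} (hg : Continuous g) :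
    ContinuousOn (fun p : Matrix ι ι ℝ × (ι → ℝ) => v ⬝ᵥ p.1⁻¹ *ᵥ g p.2) {p | p.1.PosDef} := by
  have h2 : ContinuousOn (fun p : Matrix ι ι ℝ × (ι → ℝ) => (p.1⁻¹, g p.2)) {p | p.1.PosDef} :=
    continuousOn_inv_posDef.prodMk (hg.comp_continuousOn continuousOn_snd)
  have := (continuous_dotProduct_mulVec_left v).comp_continuousOn h2
  exact this

theorem continuousOn_ellipticalDensityDeriv {G : ℝ → ℝ} (hG : Continuous (deriv G))
    (hG' : Continuous (deriv (deriv G))) (D : Matrix ι ι ℝ) :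
    ContinuousOn (fun p : Matrix ι ι ℝ × (ι → ℝ) => ellipticalDensityDeriv G p.1 D p.2)
      {p | p.1.PosDef} := by
  have hq : ContinuousOn (fun p : Matrix ι ι ℝ × (ι → ℝ) => deriv G (p.2 ⬝ᵥ p.1⁻¹ *ᵥ p.2))
      {p | p.1.PosDef} := hG.comp_continuousOn continuousOn_quadForm_inv_posDef
  have hq' : ContinuousOn (fun p : Matrix ι ι ℝ × (ι → ℝ) =>
      2 * deriv (deriv G) (p.2 ⬝ᵥ p.1⁻¹ *ᵥ p.2)) {p | p.1.PosDef} :=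
    continuousOn_const.mul (hG'.comp_continuousOn continuousOn_quadForm_inv_posDef)
  have h3 : ∀ v w : ι → ℝ, ContinuousOn (fun p : Matrix ι ι ℝ × (ι → ℝ) =>
      2 * deriv (deriv G) (p.2 ⬝ᵥ p.1⁻¹ *ᵥ p.2) * ((v ⬝ᵥ p.1⁻¹ *ᵥ p.2) * (w ⬝ᵥ p.1⁻¹ *ᵥ p.2)) +
        deriv G (p.2 ⬝ᵥ p.1⁻¹ *ᵥ p.2) * (w ⬝ᵥ p.1⁻¹ *ᵥ v)) {p | p.1.PosDef} := by
    intro v w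
    have e1 := continuousOn_dotProduct_inv_mulVec v continuous_id
    have e2 := continuousOn_dotProduct_inv_mulVec w continuous_id
    have e3 := continuousOn_dotProduct_inv_mulVec w (continuous_const (y := v))
    exact (hq'.mul (e1.mul e2)).add (hq.mul e3)
  have h4 : ContinuousOn (fun p : Matrix ι ι ℝ × (ι → ℝ) => ∑ r, ∑ s, D r s *
      (2 * deriv (deriv G) (p.2 ⬝ᵥ p.1⁻¹ *ᵥ p.2) *
        ((Pi.single r 1 ⬝ᵥ p.1⁻¹ *ᵥ p.2) * (Pi.single s 1 ⬝ᵥ p.1⁻¹ *ᵥ p.2)) +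
        deriv G (p.2 ⬝ᵥ p.1⁻¹ *ᵥ p.2) * (Pi.single s 1 ⬝ᵥ p.1⁻¹ *ᵥ Pi.single r 1)))
      {p | p.1.PosDef} := by
    refine continuousOn_finsetSum _ fun r _ => continuousOn_finsetSum _ fun s _ => ?_
    have := h3 (Pi.single r 1) (Pi.single s 1)
    exact continuousOn_const.mul this
  have h5 := continuousOn_inv_sqrt_det_posDef.mul h4
  exact h5

/-- A common compact support in `x` and a compact range of `t` bound the kernel by a constant, so
local integrability of `f` already provides a dominating function. -/
theorem exists_bound_mul_of_continuousOn {E : Type*} [NormedAddCommGroup E] [MeasurableSpace E]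
    [BorelSpace E] [SecondCountableTopology E]
    {μ : Measure E} {f : E → ℝ} (hf : LocallyIntegrable f μ) {K : Set E} (hK : IsCompact K)
    {F : ℝ → E → ℝ} {a b : ℝ}
    (hF : ContinuousOn (fun p : ℝ × E => F p.1 p.2) (Set.Icc a b ×ˢ Set.univ))
    (hF0 : ∀ t ∈ Set.Icc a b, ∀ x ∉ K, F t x = 0) :
    ∃ bound : E → ℝ, Integrable bound μ ∧
      (∀ t ∈ Set.Icc a b, ∀ x, ‖f x * F t x‖ ≤ bound x) ∧
        ∀ t ∈ Set.Icc a b, AEStronglyMeasurable (fun x => f x * F t x) μ := by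
  obtain ⟨C, hC⟩ := (isCompact_Icc.prod hK).exists_bound_of_continuousOn
    (hF.mono (Set.prod_mono subset_rfl (Set.subset_univ _)))
  refine ⟨K.indicator fun x => ‖f x‖ * C, (integrable_indicator_iff hK.measurableSet).2
      ((hf.integrableOn_isCompact hK).norm.mul_const C), fun t ht x => ?_, fun t ht => ?_⟩
  · by_cases hx : x ∈ K
    · rw [Set.indicator_of_mem hx, norm_mul]
      exact mul_le_mul_of_nonneg_left (hC (t, x) ⟨ht, hx⟩) (norm_nonneg _)
    · simp [hF0 t ht x hx, hx]
  · refine hf.aestronglyMeasurable.mul (Continuous.aestronglyMeasurable ?_)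
    have := hF.comp (f := fun x : E => (t, x)) (s := Set.univ) (by fun_prop)
      (fun x _ => ⟨ht, trivial⟩)
    exact continuousOn_univ.1 this

theorem integral_mul_le_of_hasDerivAt {E : Type*} [MeasurableSpace E]
    {μ : Measure E} {f : E → ℝ} {F F' : ℝ → E → ℝ} {C C' : E → ℝ}
    (hCi : Integrable C μ) (hC : ∀ t ∈ Set.Icc (0 : ℝ) 1, ∀ x, ‖f x * F t x‖ ≤ C x)
    (hCm : ∀ t ∈ Set.Icc (0 : ℝ) 1, AEStronglyMeasurable (fun x => f x * F t x) μ)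
    (hCm' : ∀ t ∈ Set.Icc (0 : ℝ) 1, AEStronglyMeasurable (fun x => f x * F' t x) μ)
    (hCi' : Integrable C' μ) (hC' : ∀ t ∈ Set.Icc (0 : ℝ) 1, ∀ x, ‖f x * F' t x‖ ≤ C' x)
    (hd : ∀ t ∈ Set.Icc (0 : ℝ) 1, ∀ x, HasDerivAt (fun s => F s x) (F' t x) t)
    (h0 : ∀ t ∈ Set.Icc (0 : ℝ) 1, 0 ≤ ∫ x, f x * F' t x ∂μ) :
    ∫ x, f x * F 0 x ∂μ ≤ ∫ x, f x * F 1 x ∂μ := by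
  have hcont : ContinuousOn (fun t : ℝ => ∫ x, f x * F t x ∂μ) (Set.Icc 0 1) := by
    refine continuousOn_of_dominated hCm (fun t ht => Eventually.of_forall (hC t ht)) hCi
      (Eventually.of_forall fun x => continuousOn_const.mul ?_)
    exact fun t ht => (hd t ht x).continuousAt.continuousWithinAt
  have hder : ∀ t ∈ Set.Ioo (0 : ℝ) 1,
      HasDerivAt (fun t : ℝ => ∫ x, f x * F t x ∂μ) (∫ x, f x * F' t x ∂μ) t := by
    intro t ht
    have hnhds : Set.Ioo (0 : ℝ) 1 ∈ 𝓝 t := Ioo_mem_nhds ht.1 ht.2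
    refine (hasDerivAt_integral_of_dominated_loc_of_deriv_le hnhds
      (F := fun t x => f x * F t x) (F' := fun t x => f x * F' t x)
      (bound := C') ?_ ?_ (hCm' t (Set.Ioo_subset_Icc_self ht)) ?_ hCi' ?_).2
    · filter_upwards [hnhds] with s hs using hCm s (Set.Ioo_subset_Icc_self hs)
    · exact hCi.mono' (hCm t (Set.Ioo_subset_Icc_self ht))
        (Eventually.of_forall (hC t (Set.Ioo_subset_Icc_self ht)))
    · exact Eventually.of_forall fun x s hs => hC' s (Set.Ioo_subset_Icc_self hs) x
    · exact Eventually.of_forall fun x s hs =>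
        (hd s (Set.Ioo_subset_Icc_self hs) x).const_mul (f x)
  refine monotoneOn_of_deriv_nonneg (convex_Icc 0 1) hcont ?_ ?_
    (Set.left_mem_Icc.2 zero_le_one) (Set.right_mem_Icc.2 zero_le_one) zero_le_one
  · rw [interior_Icc]
    exact fun t ht => (hder t ht).differentiableAt.differentiableWithinAt
  · rw [interior_Icc]
    intro t ht
    rw [(hder t ht).deriv]
    exact h0 t (Set.Ioo_subset_Icc_self ht)

theorem integral_mul_ellipticalDensity_le_add {A D : Matrix ι ι ℝ}
    (hpd : ∀ t ∈ Set.Icc (0 : ℝ) 1, (A + t • D).PosDef) (hA : A.IsSymm) (hDs : D.IsSymm)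
    (hD : ∀ i j, 0 ≤ D i j) (hD0 : ∀ i, D i i = 0) {f : (ι → ℝ) → ℝ} (hf : LocallyIntegrable f)
    (hsm : ∀ (x : ι → ℝ) (r s : ι) (ε δ : ℝ), r ≠ s → 0 < ε → 0 < δ →
      f (x + Pi.single r ε) + f (x + Pi.single s δ) ≤ f (x + Pi.single r ε + Pi.single s δ) + f x)
    {G : ℝ → ℝ} (hG : ContDiff ℝ 3 G) (h0 : ∀ v, 0 ≤ G v) {R : ℝ} (hR : ∀ v, R < v → G v = 0) :
    ∫ x, f x * ellipticalDensity G (A + (0 : ℝ) • D) x ≤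
      ∫ x, f x * ellipticalDensity G (A + (1 : ℝ) • D) x := by
  have hG1 := contDiff_deriv_of_three hG
  have hG2 := contDiff_deriv_of_two hG1
  have hR1 := deriv_eq_zero_of_eq_zero_of_lt hR
  have hR2 := deriv_eq_zero_of_eq_zero_of_lt hR1
  obtain ⟨K, hKc, hout⟩ : ∃ K : Set (ι → ℝ), IsCompact K ∧
      ∀ t ∈ Set.Icc (0 : ℝ) 1, ∀ x ∉ K, R < x ⬝ᵥ (A + t • D)⁻¹ *ᵥ x := by
    -- One ball serves every `t`, since `A + t • D` has the diagonal of `A`.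
    refine ⟨Metric.closedBall 0 (√((∑ i, A i i) * R)), isCompact_closedBall _ _,
      fun t ht x hx => ?_⟩
    by_contra h
    refine hx ?_
    rw [mem_closedBall_zero_iff]
    refine (hpd t ht).norm_le_of_quadForm_le (fun i => ?_) x (not_lt.1 h)
    have hdiag : ∀ j, 0 ≤ A j j := fun j => by
      simpa [hD0] using (hpd t ht).diag_pos (i := j) |>.le
    simpa [hD0] using Finset.single_le_sum (f := fun i => A i i) (fun j _ => hdiag j)
      (Finset.mem_univ i)
  have hc : Continuous fun p : ℝ × (ι → ℝ) => (A + p.1 • D, p.2) :=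
    (continuous_const.add (continuous_fst.smul continuous_const)).prodMk continuous_snd
  have hM : ContinuousOn (fun p : ℝ × (ι → ℝ) => (A + p.1 • D, p.2)) (Set.Icc 0 1 ×ˢ Set.univ) :=
    hc.continuousOn
  have hMm : Set.MapsTo (fun p : ℝ × (ι → ℝ) => (A + p.1 • D, p.2)) (Set.Icc 0 1 ×ˢ Set.univ)
      {p : Matrix ι ι ℝ × (ι → ℝ) | p.1.PosDef} := fun p hp => hpd _ hp.1
  have hψ := (continuousOn_ellipticalDensity (ι := ι) hG1.continuous).comp hM hMm
  have hψ' := (continuousOn_ellipticalDensityDeriv hG1.continuous hG2.continuous D).comp hM hMm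
  obtain ⟨C, hCi, hC, hCm⟩ := exists_bound_mul_of_continuousOn hf hKc
    (F := fun t => ellipticalDensity G (A + t • D)) hψ fun t ht x hx => by
      simp only [ellipticalDensity, hR1 _ (hout t ht x hx), mul_zero]
  obtain ⟨C', hCi', hC', hCm'⟩ := exists_bound_mul_of_continuousOn hf hKc
    (F := fun t => ellipticalDensityDeriv G (A + t • D) D) hψ' fun t ht x hx => by
      simp only [ellipticalDensityDeriv, hR1 _ (hout t ht x hx), hR2 _ (hout t ht x hx), mul_zero,
        zero_mul, add_zero, Finset.sum_const_zero]
  exact integral_mul_le_of_hasDerivAt hCi hC hCm hCm' hCi' hC'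
    (fun t ht x => hasDerivAt_ellipticalDensity hG hA hDs (hpd t ht) x)
    fun t ht => integral_mul_ellipticalDensityDeriv_nonneg (hpd t ht) hD hD0 hf hsm hG h0 hR

theorem integral_mul_ellipticalDensity_le {A B : Matrix ι ι ℝ} (hA : A.PosDef) (hB : B.PosDef)
    (hdiag : ∀ i, A i i = B i i) (hle : ∀ i j, A i j ≤ B i j) {f : (ι → ℝ) → ℝ}
    (hf : LocallyIntegrable f)
    (hsm : ∀ (x : ι → ℝ) (r s : ι) (ε δ : ℝ), r ≠ s → 0 < ε → 0 < δ →
      f (x + Pi.single r ε) + f (x + Pi.single s δ) ≤ f (x + Pi.single r ε + Pi.single s δ) + f x)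
    {G : ℝ → ℝ} (hG : ContDiff ℝ 3 G) (h0 : ∀ v, 0 ≤ G v) {R : ℝ} (hR : ∀ v, R < v → G v = 0) :
    ∫ x, f x * ellipticalDensity G A x ≤ ∫ x, f x * ellipticalDensity G B x := by
  have := integral_mul_ellipticalDensity_le_add (A := A) (D := B - A)
    (fun t ht => hA.add_smul_sub hB ht) hA.isSymm (hB.isSymm.sub hA.isSymm)
    (fun i j => sub_nonneg.2 (hle i j)) (fun i => sub_eq_zero.2 (hdiag i).symm) hf hsm hG h0 hR
  rwa [zero_smul, add_zero, one_smul, add_sub_cancel] at this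

end

/-! ### Gaussian densities as limits of compactly supported kernels -/

section

/-- The function `v ↦ exp (-v / 2)`, smoothly cut off between `K` and `2 K`. -/
def expCutoff (K : ℝ) (v : ℝ) : ℝ := Real.exp (-v / 2) * Real.smoothTransition (2 - v / K)

theorem contDiff_expCutoff (K : ℝ) : ContDiff ℝ 3 (expCutoff K) := by
  have h : ContDiff ℝ 3 Real.smoothTransition := Real.smoothTransition.contDiff (n := 3)
  exact (Real.contDiff_exp.comp (by fun_prop)).mul (h.comp (by fun_prop))

theorem expCutoff_nonneg (K v : ℝ) : 0 ≤ expCutoff K v :=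
  mul_nonneg (Real.exp_pos _).le (Real.smoothTransition.nonneg _)

theorem expCutoff_eq_zero {K : ℝ} (hK : 0 < K) (v : ℝ) (hv : 2 * K < v) : expCutoff K v = 0 := by
  rw [expCutoff, Real.smoothTransition.zero_of_nonpos, mul_zero]
  rw [sub_nonpos, le_div_iff₀ hK]
  exact hv.le

theorem neg_two_mul_deriv_expCutoff (K v : ℝ) : -2 * deriv (expCutoff K) v =
    Real.exp (-v / 2) * (Real.smoothTransition (2 - v / K) +
      2 / K * deriv Real.smoothTransition (2 - v / K)) := by
  have h1 : HasDerivAt (fun v : ℝ => Real.exp (-v / 2)) (Real.exp (-v / 2) * (-1 / 2)) v :=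
    ((hasDerivAt_id v).neg.div_const 2).exp
  have h2 : HasDerivAt (fun v : ℝ => 2 - v / K) (-(1 / K)) v :=
    ((hasDerivAt_id v).div_const K).const_sub 2
  have h3 : HasDerivAt Real.smoothTransition (deriv Real.smoothTransition (2 - v / K))
      (2 - v / K) :=
    ((Real.smoothTransition.contDiff (n := 1)).differentiable (by norm_num) _).hasDerivAt
  have h4 : HasDerivAt (expCutoff K) _ v :=
    h1.mul (HasDerivAt.comp (h := fun v : ℝ => 2 - v / K) v h3 h2)
  rw [h4.deriv]
  ring

theorem exists_abs_deriv_smoothTransition_le :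
    ∃ C, ∀ x, |deriv Real.smoothTransition x| ≤ C := by
  have hc : Continuous (deriv Real.smoothTransition) :=
    (Real.smoothTransition.contDiff (n := 1)).continuous_deriv (by norm_num)
  have hs : HasCompactSupport (deriv Real.smoothTransition) := by
    refine HasCompactSupport.intro (isCompact_Icc (a := 0) (b := 1)) fun x hx => ?_
    rw [Set.mem_Icc, not_and_or, not_le, not_le] at hx
    rcases hx with hx | hx
    · have : Real.smoothTransition =ᶠ[𝓝 x] fun _ => 0 := by
        filter_upwards [gt_mem_nhds hx] with y hy using
          Real.smoothTransition.zero_of_nonpos (le_of_lt hy)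
      rw [this.deriv_eq, deriv_const]
    · have : Real.smoothTransition =ᶠ[𝓝 x] fun _ => 1 := by
        filter_upwards [lt_mem_nhds hx] with y hy using
          Real.smoothTransition.one_of_one_le (le_of_lt hy)
      rw [this.deriv_eq, deriv_const]
  simpa using hs.exists_bound_of_continuous hc

theorem deriv_smoothTransition_of_one_lt {x : ℝ} (hx : 1 < x) :
    deriv Real.smoothTransition x = 0 := by
  have : Real.smoothTransition =ᶠ[𝓝 x] fun _ => 1 := by
    filter_upwards [lt_mem_nhds hx] with y hy using
      Real.smoothTransition.one_of_one_le (le_of_lt hy)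
  rw [this.deriv_eq, deriv_const]

theorem neg_two_mul_deriv_expCutoff_of_lt {K v : ℝ} (hK : 0 < K) (hv : v < K) :
    -2 * deriv (expCutoff K) v = Real.exp (-v / 2) := by
  have h : 1 < 2 - v / K := by
    have := (div_lt_one hK).2 hv
    linarith
  rw [neg_two_mul_deriv_expCutoff, deriv_smoothTransition_of_one_lt h,
    Real.smoothTransition.one_of_one_le h.le]
  ring

/-- The constant does not depend on `K`: differentiating the cutoff costs a factor `2 / K ≤ 2`. This
gives a single dominating function for the limit `K → ∞`. -/
theorem exists_abs_neg_two_mul_deriv_expCutoff_le :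
    ∃ C, ∀ K v : ℝ, 1 ≤ K → |-2 * deriv (expCutoff K) v| ≤ C * Real.exp (-v / 2) := by
  obtain ⟨C, hC⟩ := exists_abs_deriv_smoothTransition_le
  have hC0 : 0 ≤ C := (abs_nonneg _).trans (hC 0)
  refine ⟨1 + 2 * C, fun K v hK => ?_⟩
  rw [neg_two_mul_deriv_expCutoff, abs_mul, abs_of_pos (Real.exp_pos _), mul_comm]
  refine mul_le_mul_of_nonneg_right ((abs_add_le _ _).trans (add_le_add ?_ ?_)) (Real.exp_pos _).le
  · rw [abs_of_nonneg (Real.smoothTransition.nonneg _)]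
    exact Real.smoothTransition.le_one _
  · rw [abs_mul, abs_of_nonneg (by positivity)]
    refine mul_le_mul ?_ (hC _) (abs_nonneg _) (by norm_num)
    rw [div_le_iff₀ (by linarith)]
    linarith

variable {ι : Type*} [Fintype ι] [DecidableEq ι]

/-- The density of the centred normal distribution with covariance matrix `A`. -/
def gaussDensity (A : Matrix ι ι ℝ) (x : ι → ℝ) : ℝ :=
  (√((2 * Real.pi) ^ Fintype.card ι * A.det))⁻¹ * Real.exp (-(1 / 2) * (x ⬝ᵥ A⁻¹ *ᵥ x))

theorem continuous_gaussDensity (A : Matrix ι ι ℝ) : Continuous (gaussDensity A) :=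
  continuous_const.mul
    (Real.continuous_exp.comp (continuous_const.mul (contDiff_quadForm (n := 0) A⁻¹).continuous))

theorem gaussDensity_pos {A : Matrix ι ι ℝ} (hA : A.PosDef) (x : ι → ℝ) : 0 < gaussDensity A x := by
  have := hA.det_pos
  unfold gaussDensity
  positivity

theorem gaussDensity_neg (A : Matrix ι ι ℝ) (x : ι → ℝ) :
    gaussDensity A (-x) = gaussDensity A x := by
  simp [gaussDensity, Matrix.mulVec_neg]

theorem locallyIntegrable_of_integrable_mul {E : Type*} [TopologicalSpace E] [T2Space E]
    [LocallyCompactSpace E] [MeasurableSpace E] [OpensMeasurableSpace E] {μ : Measure E}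
    {f φ : E → ℝ} (h : Integrable (fun x => f x * φ x) μ) (hφ : Continuous φ)
    (h0 : ∀ x, φ x ≠ 0) : LocallyIntegrable f μ := by
  have h2 := h.locallyIntegrable.mul_continuous (hφ.inv₀ h0)
  refine h2.congr (Eventually.of_forall fun x => ?_)
  simp [h0 x]

/-- At a fixed `x` the truncated kernel equals the Gaussian one as soon as the cutoff level exceeds
the quadratic form, and a multiple of `|f|` times the Gaussian density dominates. The prefactor
supplies the powers of `2π` absent from `ellipticalDensity`. -/
theorem tendsto_integral_mul_ellipticalDensity_expCutoff {A : Matrix ι ι ℝ}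
    {f : (ι → ℝ) → ℝ} (hf : LocallyIntegrable f)
    (hi : Integrable fun x => f x * gaussDensity A x) :
    Tendsto (fun k : ℕ => (√((2 * Real.pi) ^ Fintype.card ι))⁻¹ *
      ∫ x, f x * ellipticalDensity (expCutoff (k + 1)) A x) atTop
      (𝓝 (∫ x, f x * gaussDensity A x)) := by
  obtain ⟨C, hC⟩ := exists_abs_neg_two_mul_deriv_expCutoff_le
  simp_rw [← integral_const_mul]
  have e : ∀ (K : ℝ) x, (√((2 * Real.pi) ^ Fintype.card ι))⁻¹ *
      (f x * ellipticalDensity (expCutoff K) A x) =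
      f x * ((√((2 * Real.pi) ^ Fintype.card ι * A.det))⁻¹ *
        (-2 * deriv (expCutoff K) (x ⬝ᵥ A⁻¹ *ᵥ x))) := by
    intro K x
    rw [Real.sqrt_mul (by positivity), mul_inv, ellipticalDensity]
    ring
  simp_rw [e]
  have e2 : ∀ v : ℝ, -(1 / 2) * v = -v / 2 := fun v => by ring
  have hq := (contDiff_quadForm (n := 0) A⁻¹).continuous
  refine tendsto_integral_of_dominated_convergence (fun x => C * ‖f x * gaussDensity A x‖)
    (fun k => ?_) (hi.norm.const_mul C) (fun k => Eventually.of_forall fun x => ?_)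
    (Eventually.of_forall fun x => ?_)
  · have h1 := (contDiff_deriv_of_three (contDiff_expCutoff ((k : ℝ) + 1))).continuous
    exact hf.aestronglyMeasurable.mul
      (continuous_const.mul (continuous_const.mul (h1.comp hq))).aestronglyMeasurable
  · have h2 := hC ((k : ℝ) + 1) (x ⬝ᵥ A⁻¹ *ᵥ x) (by simp)
    rw [← Real.norm_eq_abs] at h2
    generalize -2 * deriv (expCutoff ((k : ℝ) + 1)) (x ⬝ᵥ A⁻¹ *ᵥ x) = z at h2 ⊢
    simp only [gaussDensity, e2, norm_mul]
    rw [Real.norm_eq_abs (Real.exp _), Real.abs_exp]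
    calc _ ≤ ‖f x‖ * (‖(√((2 * Real.pi) ^ Fintype.card ι * A.det))⁻¹‖ *
          (C * Real.exp (-(x ⬝ᵥ A⁻¹ *ᵥ x) / 2))) := by gcongr
      _ = _ := by ring
  · refine tendsto_const_nhds.congr' ?_
    obtain ⟨N, hN⟩ := exists_nat_gt (x ⬝ᵥ A⁻¹ *ᵥ x)
    filter_upwards [eventually_ge_atTop N] with k hk
    have hk' : (N : ℝ) ≤ k := by exact_mod_cast hk
    rw [neg_two_mul_deriv_expCutoff_of_lt (by positivity) (by linarith), gaussDensity, e2]

/-- Centred normal distributions with the same variances are ordered in the supermodular order if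
their covariances are. -/
theorem integral_mul_gaussDensity_le {A B : Matrix ι ι ℝ} (hA : A.PosDef) (hB : B.PosDef)
    (hdiag : ∀ i, A i i = B i i) (hle : ∀ i j, A i j ≤ B i j) {f : (ι → ℝ) → ℝ}
    (hsm : ∀ (x : ι → ℝ) (r s : ι) (ε δ : ℝ), r ≠ s → 0 < ε → 0 < δ →
      f (x + Pi.single r ε) + f (x + Pi.single s δ) ≤ f (x + Pi.single r ε + Pi.single s δ) + f x)
    (hfA : Integrable fun x => f x * gaussDensity A x)
    (hfB : Integrable fun x => f x * gaussDensity B x) :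
    ∫ x, f x * gaussDensity A x ≤ ∫ x, f x * gaussDensity B x := by
  have hf : LocallyIntegrable f := locallyIntegrable_of_integrable_mul hfA
    (continuous_gaussDensity A) fun x => (gaussDensity_pos hA x).ne'
  refine le_of_tendsto_of_tendsto' (tendsto_integral_mul_ellipticalDensity_expCutoff hf hfA)
    (tendsto_integral_mul_ellipticalDensity_expCutoff hf hfB) fun k => ?_
  refine mul_le_mul_of_nonneg_left ?_ (by positivity)
  exact integral_mul_ellipticalDensity_le hA hB hdiag hle hf hsm (contDiff_expCutoff _)
    (expCutoff_nonneg _) (R := 2 * ((k : ℝ) + 1)) (expCutoff_eq_zero (by positivity))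

end

/-! ### The skew-normal law as a half-normal mixture of Gaussians -/

section

theorem gaussianPDFReal_zero_one (x : ℝ) :
    gaussianPDFReal 0 1 x = (√(2 * Real.pi))⁻¹ * Real.exp (-(1 / 2) * x ^ 2) := by
  rw [gaussianPDFReal]
  simp only [NNReal.coe_one, mul_one, sub_zero]
  congr 2
  ring

theorem cdf_gaussianReal_zero_one (s : ℝ) :
    cdf (gaussianReal 0 1) s = ∫ v in Set.Iic s, gaussianPDFReal 0 1 v := by
  rw [cdf_eq_real, Measure.real, gaussianReal_apply_eq_integral 0 one_ne_zero,
    ENNReal.toReal_ofReal (integral_nonneg fun x => gaussianPDFReal_nonneg 0 1 x)]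

/-- After rescaling and translating, the integral is the mass of `(-s, ∞)`, which equals the mass of
`(-∞, s)` by symmetry. -/
theorem integral_Ioi_gaussianPDFReal_mul_sub {κ : ℝ} (hκ : 0 < κ) (s : ℝ) :
    ∫ u in Set.Ioi (0 : ℝ), κ * gaussianPDFReal 0 1 (κ * u - s) = cdf (gaussianReal 0 1) s := by
  rw [cdf_gaussianReal_zero_one, integral_const_mul,
    integral_comp_mul_left_Ioi (fun v => gaussianPDFReal 0 1 (v - s)) 0 hκ, mul_zero, smul_eq_mul,
    mul_inv_cancel_left₀ hκ.ne']
  have h1 : ∀ v : ℝ, gaussianPDFReal 0 1 (v - s) = gaussianPDFReal 0 1 (s + -v) := fun v => by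
    rw [gaussianPDFReal_zero_one, gaussianPDFReal_zero_one]
    congr 3
    ring
  simp_rw [h1]
  rw [integral_comp_neg_Ioi 0 fun w => gaussianPDFReal 0 1 (s + w), neg_zero]
  have := (measurePreserving_add_left (volume : Measure ℝ) s).setIntegral_preimage_emb
    (Homeomorph.addLeft s).measurableEmbedding (gaussianPDFReal 0 1) (Set.Iic s)
  rw [← this]
  congr 2
  ext w
  simp

theorem integrableOn_Ioi_gaussianPDFReal_mul_sub {κ : ℝ} (hκ : 0 < κ) (s : ℝ) :
    IntegrableOn (fun u => κ * gaussianPDFReal 0 1 (κ * u - s)) (Set.Ioi (0 : ℝ)) := by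
  refine Integrable.integrableOn (Integrable.const_mul ?_ _)
  exact ((integrable_gaussianPDFReal 0 1).comp_sub_right s).comp_mul_left' hκ.ne'

theorem cdf_gaussianReal_add_cdf_neg (s : ℝ) :
    cdf (gaussianReal 0 1) s + cdf (gaussianReal 0 1) (-s) = 1 := by
  have h1 : ∫ v in Set.Iic (-s), gaussianPDFReal 0 1 v = ∫ v in Set.Ioi s, gaussianPDFReal 0 1 v := by
    rw [← integral_comp_neg_Ioi]
    simp [gaussianPDFReal_zero_one]
  rw [cdf_gaussianReal_zero_one, cdf_gaussianReal_zero_one, h1, ← integral_gaussianPDFReal_eq_one 0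
    one_ne_zero, ← Set.compl_Iic]
  exact integral_add_compl measurableSet_Iic (integrable_gaussianPDFReal 0 1)

variable {ι : Type*} [Fintype ι]

/-- The normalizing constant `√(1 + bᵀ A b)`. -/
def skewScale (A : Matrix ι ι ℝ) (b : ι → ℝ) : ℝ := √(1 + b ⬝ᵥ A *ᵥ b)

theorem skewScale_pos {A : Matrix ι ι ℝ} (hA : A.PosDef) (b : ι → ℝ) : 0 < skewScale A b :=
  Real.sqrt_pos.2 (by linarith [hA.dotProduct_mulVec_self_nonneg b])

theorem sq_skewScale {A : Matrix ι ι ℝ} (hA : A.PosDef) (b : ι → ℝ) :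
    skewScale A b ^ 2 = 1 + b ⬝ᵥ A *ᵥ b :=
  Real.sq_sqrt (by linarith [hA.dotProduct_mulVec_self_nonneg b])

/-- The vector `A b / √(1 + bᵀ A b)`. -/
def skewDir (A : Matrix ι ι ℝ) (b : ι → ℝ) : ι → ℝ := (skewScale A b)⁻¹ • A *ᵥ b

theorem dotProduct_skewDir {A : Matrix ι ι ℝ} (hA : A.PosDef) (b : ι → ℝ) :
    b ⬝ᵥ skewDir A b = skewScale A b - (skewScale A b)⁻¹ := by
  have := skewScale_pos hA b
  rw [skewDir, dotProduct_smul, smul_eq_mul, eq_sub_of_add_eq' (sq_skewScale hA b).symm]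
  field_simp

variable [DecidableEq ι]

/-- The covariance matrix `A - δ δᵀ` of the normal part of a skew-normal vector. -/
def skewCov (A : Matrix ι ι ℝ) (b : ι → ℝ) : Matrix ι ι ℝ :=
  A - Matrix.vecMulVec (skewDir A b) (skewDir A b)

theorem inv_mulVec_skewDir {A : Matrix ι ι ℝ} (hA : A.PosDef) (b : ι → ℝ) :
    A⁻¹ *ᵥ skewDir A b = (skewScale A b)⁻¹ • b := by
  rw [skewDir, Matrix.mulVec_smul, Matrix.mulVec_mulVec,
    Matrix.nonsing_inv_mul _ hA.det_pos.ne'.isUnit, Matrix.one_mulVec]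

/-- The Sherman–Morrison formula. With `κ = skewScale A b`, the relations `A b = κ δ` and `b · δ = κ
- κ⁻¹` make all rank-one terms cancel. -/
theorem inv_add_vecMulVec_mul_skewCov {A : Matrix ι ι ℝ} (hA : A.PosDef) (b : ι → ℝ) :
    (A⁻¹ + Matrix.vecMulVec b b) * skewCov A b = 1 := by
  have hκ := skewScale_pos hA b
  have h1 : Matrix.vecMulVec b b * A = skewScale A b • Matrix.vecMulVec b (skewDir A b) := by
    rw [Matrix.vecMulVec_mul, skewDir, ← Matrix.mulVec_transpose, hA.isSymm.eq,
      Matrix.vecMulVec_smul, smul_smul, mul_inv_cancel₀ hκ.ne', one_smul]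
  rw [skewCov, add_mul, mul_sub, mul_sub, Matrix.nonsing_inv_mul _ hA.det_pos.ne'.isUnit,
    Matrix.mul_vecMulVec, inv_mulVec_skewDir hA, Matrix.smul_vecMulVec, h1,
    Matrix.vecMulVec_mul_vecMulVec, dotProduct_skewDir hA, Matrix.vecMulVec_smul, sub_smul]
  abel

theorem inv_skewCov {A : Matrix ι ι ℝ} (hA : A.PosDef) (b : ι → ℝ) :
    (skewCov A b)⁻¹ = A⁻¹ + Matrix.vecMulVec b b :=
  Matrix.inv_eq_left_inv (inv_add_vecMulVec_mul_skewCov hA b)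

/-- Positivity of `A - δδᵀ` is not obvious directly, but its inverse `A⁻¹ + bbᵀ` is visibly positive
definite. -/
theorem posDef_skewCov {A : Matrix ι ι ℝ} (hA : A.PosDef) (b : ι → ℝ) : (skewCov A b).PosDef := by
  have h1 : (A⁻¹ + Matrix.vecMulVec b b).PosDef :=
    hA.inv.add_posSemidef (by simpa using Matrix.posSemidef_vecMulVec_self_star b)
  have h2 : (A⁻¹ + Matrix.vecMulVec b b)⁻¹ = skewCov A b :=
    Matrix.inv_eq_right_inv (inv_add_vecMulVec_mul_skewCov hA b)
  exact h2 ▸ h1.inv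

/-- The matrix determinant lemma applied to `A⁻¹ + bbᵀ`. -/
theorem det_eq_sq_skewScale_mul_det_skewCov {A : Matrix ι ι ℝ} (hA : A.PosDef) (b : ι → ℝ) :
    A.det = skewScale A b ^ 2 * (skewCov A b).det := by
  have h1 := congrArg Matrix.det (inv_add_vecMulVec_mul_skewCov hA b)
  have hu : IsUnit (A⁻¹).det := hA.inv.det_pos.ne'.isUnit
  have h2 : (A⁻¹ + Matrix.vecMulVec b b).det = A.det⁻¹ * skewScale A b ^ 2 := by
    rw [Matrix.vecMulVec_eq Unit, Matrix.det_add_replicateCol_mul_replicateRow hu,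
      Matrix.nonsing_inv_nonsing_inv _ hA.det_pos.ne'.isUnit, Matrix.det_nonsing_inv,
      Ring.inverse_eq_inv', sq_skewScale hA]
    congr 1
    rw [Matrix.det_unique, Matrix.add_apply, Matrix.dotProduct_mulVec]
    simp [Matrix.mul_apply, Matrix.vecMul, dotProduct]
  rw [Matrix.det_mul, h2, Matrix.det_one] at h1
  have := hA.det_pos
  field_simp at h1
  linarith

/-- The density of the standardized skew-normal distribution on `ι → ℝ`. -/
def skewDensity (A : Matrix ι ι ℝ) (b : ι → ℝ) (z : ι → ℝ) : ℝ :=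
  2 * gaussDensity A z * cdf (gaussianReal 0 1) (b ⬝ᵥ z)

/-- The joint density at `(u, z)` of `(|U|, δ |U| + W)`, where `U` is standard normal and `W` is
normal with covariance matrix `Γ`. -/
def mixDensity (Γ : Matrix ι ι ℝ) (δ : ι → ℝ) (u : ℝ) (z : ι → ℝ) : ℝ :=
  2 * gaussianPDFReal 0 1 u * gaussDensity Γ (z - u • δ)

/-- Completing the square in `u`: adding `u²` to the form of `z - uδ` leaves `zᵀ A⁻¹ z + (κu - b ·
z)²`. Integrating the last factor over `u > 0` then produces the distribution function in the
skew-normal density. -/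
theorem mixDensity_skewCov {A : Matrix ι ι ℝ} (hA : A.PosDef) (b : ι → ℝ) (u : ℝ) (z : ι → ℝ) :
    mixDensity (skewCov A b) (skewDir A b) u z = 2 * gaussDensity A z *
      (skewScale A b * gaussianPDFReal 0 1 (skewScale A b * u - b ⬝ᵥ z)) := by
  have hκ := skewScale_pos hA b
  set κ := skewScale A b with hκd
  set δ := skewDir A b with hδ
  have hquad : (z - u • δ) ⬝ᵥ (skewCov A b)⁻¹ *ᵥ (z - u • δ) =
      z ⬝ᵥ A⁻¹ *ᵥ z + (κ * u - b ⬝ᵥ z) ^ 2 - u ^ 2 := by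
    have e1 : δ ⬝ᵥ A⁻¹ *ᵥ z = κ⁻¹ * (b ⬝ᵥ z) := by
      rw [dotProduct_mulVec_comm_of_isSymm hA.inv.isSymm, hδ, inv_mulVec_skewDir hA,
        dotProduct_smul, smul_eq_mul, dotProduct_comm]
    have e2 : A⁻¹ *ᵥ δ = κ⁻¹ • b := inv_mulVec_skewDir hA b
    have e3 : b ⬝ᵥ δ = κ - κ⁻¹ := dotProduct_skewDir hA b
    have e4 : δ ⬝ᵥ b = κ - κ⁻¹ := by rw [dotProduct_comm, e3]
    rw [inv_skewCov hA, Matrix.add_mulVec, Matrix.vecMulVec_mulVec, dotProduct_add]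
    simp only [Matrix.mulVec_sub, Matrix.mulVec_smul, sub_dotProduct, dotProduct_sub,
      smul_dotProduct, dotProduct_smul, smul_eq_mul, e1, e2, e3, e4, op_smul_eq_smul]
    rw [dotProduct_comm z b]
    field_simp
    ring
  have hdet : √((2 * Real.pi) ^ Fintype.card ι * A.det) =
      κ * √((2 * Real.pi) ^ Fintype.card ι * (skewCov A b).det) := by
    rw [det_eq_sq_skewScale_mul_det_skewCov hA b, ← hκd, mul_left_comm,
      Real.sqrt_mul (by positivity), Real.sqrt_sq hκ.le]
  simp only [mixDensity, gaussDensity, gaussianPDFReal_zero_one]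
  rw [hquad, hdet, mul_inv]
  have hexp : Real.exp (-(1 / 2) * u ^ 2) *
      Real.exp (-(1 / 2) * (z ⬝ᵥ A⁻¹ *ᵥ z + (κ * u - b ⬝ᵥ z) ^ 2 - u ^ 2)) =
      Real.exp (-(1 / 2) * (z ⬝ᵥ A⁻¹ *ᵥ z)) * Real.exp (-(1 / 2) * (κ * u - b ⬝ᵥ z) ^ 2) := by
    rw [← Real.exp_add, ← Real.exp_add]
    congr 1
    ring
  calc _ = 2 * (√(2 * Real.pi))⁻¹ * (√((2 * Real.pi) ^ Fintype.card ι * (skewCov A b).det))⁻¹ *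
        (Real.exp (-(1 / 2) * u ^ 2) *
      Real.exp (-(1 / 2) * (z ⬝ᵥ A⁻¹ *ᵥ z + (κ * u - b ⬝ᵥ z) ^ 2 - u ^ 2))) := by ring
    _ = _ := by
      rw [hexp]
      field_simp

theorem integral_mixDensity {A : Matrix ι ι ℝ} (hA : A.PosDef) (b : ι → ℝ) (z : ι → ℝ) :
    ∫ u in Set.Ioi (0 : ℝ), mixDensity (skewCov A b) (skewDir A b) u z = skewDensity A b z := by
  simp_rw [mixDensity_skewCov hA]
  rw [integral_const_mul, integral_Ioi_gaussianPDFReal_mul_sub (skewScale_pos hA b), skewDensity]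

theorem integrableOn_mixDensity {A : Matrix ι ι ℝ} (hA : A.PosDef) (b : ι → ℝ) (z : ι → ℝ) :
    IntegrableOn (fun u => mixDensity (skewCov A b) (skewDir A b) u z) (Set.Ioi (0 : ℝ)) := by
  simp_rw [mixDensity_skewCov hA]
  exact (integrableOn_Ioi_gaussianPDFReal_mul_sub (skewScale_pos hA b) _).const_mul _

theorem mixDensity_nonneg {Γ : Matrix ι ι ℝ} (hΓ : Γ.PosDef) (δ : ι → ℝ) (u : ℝ) (z : ι → ℝ) :
    0 ≤ mixDensity Γ δ u z :=
  mul_nonneg (mul_nonneg zero_le_two (gaussianPDFReal_nonneg _ _ _)) (gaussDensity_pos hΓ _).le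

theorem measurable_mixDensity (Γ : Matrix ι ι ℝ) (δ : ι → ℝ) :
    Measurable fun p : ℝ × (ι → ℝ) => mixDensity Γ δ p.1 p.2 := by
  have h1 : Continuous fun p : ℝ × (ι → ℝ) => gaussDensity Γ (p.2 - p.1 • δ) :=
    (continuous_gaussDensity Γ).comp
      (continuous_snd.sub (continuous_fst.smul continuous_const))
  exact (((measurable_gaussianPDFReal 0 1).comp measurable_fst).const_mul 2).mul h1.measurable

theorem skewDensity_nonneg {A : Matrix ι ι ℝ} (hA : A.PosDef) (b : ι → ℝ) (z : ι → ℝ) :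
    0 ≤ skewDensity A b z :=
  mul_nonneg (mul_nonneg zero_le_two (gaussDensity_pos hA _).le) (cdf_nonneg _ _)

/-- Disintegration of integrals against a skew-normal density along the latent half-normal
variable. -/
theorem integrable_mul_mixDensity {A : Matrix ι ι ℝ} (hA : A.PosDef) (b : ι → ℝ)
    {f : (ι → ℝ) → ℝ} (hf : Measurable f) (hi : Integrable fun z => f z * skewDensity A b z) :
    Integrable (fun p : ℝ × (ι → ℝ) => f p.2 * mixDensity (skewCov A b) (skewDir A b) p.1 p.2)
      ((volume.restrict (Set.Ioi (0 : ℝ))).prod volume) := by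
  have hm : AEStronglyMeasurable
      (fun p : ℝ × (ι → ℝ) => f p.2 * mixDensity (skewCov A b) (skewDir A b) p.1 p.2)
      ((volume.restrict (Set.Ioi (0 : ℝ))).prod volume) :=
    ((hf.comp measurable_snd).mul (measurable_mixDensity _ _)).aestronglyMeasurable
  refine (integrable_prod_iff' hm).2 ⟨Eventually.of_forall fun z => ?_, ?_⟩
  · have := (integrableOn_mixDensity hA b z).const_mul (f z)
    exact this
  · refine hi.norm.congr (Eventually.of_forall fun z => ?_)
    simp only [norm_mul, Real.norm_eq_abs, abs_of_nonneg (skewDensity_nonneg hA b z),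
      abs_of_nonneg (mixDensity_nonneg (posDef_skewCov hA b) (skewDir A b) _ z)]
    rw [integral_const_mul, integral_mixDensity hA]

/-- Fubini, followed by the translation `z = w + uδ`. This moves the dependence on `u` from the
density to the argument of `f`, where it does not affect supermodularity. -/
theorem integral_mul_skewDensity {A : Matrix ι ι ℝ} (hA : A.PosDef) (b : ι → ℝ)
    {f : (ι → ℝ) → ℝ} (hf : Measurable f) (hi : Integrable fun z => f z * skewDensity A b z) :
    ∫ z, f z * skewDensity A b z = ∫ u in Set.Ioi (0 : ℝ), 2 * gaussianPDFReal 0 1 u *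
      ∫ w, f (w + u • skewDir A b) * gaussDensity (skewCov A b) w := by
  have h1 := integral_integral_swap
    (f := fun u z => f z * mixDensity (skewCov A b) (skewDir A b) u z)
    (integrable_mul_mixDensity hA b hf hi)
  simp_rw [integral_const_mul, integral_mixDensity hA] at h1
  rw [← h1]
  refine integral_congr_ae (Eventually.of_forall fun u => ?_)
  simp only
  rw [← integral_const_mul, ← integral_add_right_eq_self _ (u • skewDir A b)]
  refine integral_congr_ae (Eventually.of_forall fun w => ?_)
  simp only [mixDensity, add_sub_cancel_right]
  ring

/-- Without growth conditions on `f`, Fubini gives conditional integrability only for almost every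
`u`; this is enough for comparing the outer integrals. -/
theorem ae_integrable_mul_gaussDensity {A : Matrix ι ι ℝ} (hA : A.PosDef) (b : ι → ℝ)
    {f : (ι → ℝ) → ℝ} (hf : Measurable f) (hi : Integrable fun z => f z * skewDensity A b z) :
    ∀ᵐ u ∂(volume.restrict (Set.Ioi (0 : ℝ))),
      Integrable fun w => f (w + u • skewDir A b) * gaussDensity (skewCov A b) w := by
  filter_upwards [(integrable_mul_mixDensity hA b hf hi).prod_right_ae] with u hu
  have h1 := (hu.comp_add_right (u • skewDir A b)).const_mul (2 * gaussianPDFReal 0 1 u)⁻¹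
  refine h1.congr (Eventually.of_forall fun w => ?_)
  have := gaussianPDFReal_pos 0 1 u one_ne_zero
  simp only [mixDensity, add_sub_cancel_right]
  field_simp

theorem integrable_gaussianPDFReal_mul_integral {A : Matrix ι ι ℝ} (hA : A.PosDef) (b : ι → ℝ)
    {f : (ι → ℝ) → ℝ} (hf : Measurable f) (hi : Integrable fun z => f z * skewDensity A b z) :
    IntegrableOn (fun u => 2 * gaussianPDFReal 0 1 u *
      ∫ w, f (w + u • skewDir A b) * gaussDensity (skewCov A b) w) (Set.Ioi (0 : ℝ)) := by
  refine (integrable_mul_mixDensity hA b hf hi).integral_prod_left.congr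
    (Eventually.of_forall fun u => ?_)
  simp only
  rw [← integral_const_mul, ← integral_add_right_eq_self _ (u • skewDir A b)]
  refine integral_congr_ae (Eventually.of_forall fun w => ?_)
  simp only [mixDensity, add_sub_cancel_right]
  ring

/-- Standardized skew-normal distributions with the same skewness parameter `δ` and the same
variances are ordered in the supermodular order if their dispersion matrices are. -/
theorem integral_mul_skewDensity_le {A A' : Matrix ι ι ℝ} (hA : A.PosDef) (hA' : A'.PosDef)
    {b b' : ι → ℝ} (hδ : skewDir A b = skewDir A' b')
    (hdiag : ∀ i, A i i = A' i i) (hle : ∀ i j, A i j ≤ A' i j) {f : (ι → ℝ) → ℝ}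
    (hf : Measurable f)
    (hsm : ∀ (x : ι → ℝ) (r s : ι) (ε δ : ℝ), r ≠ s → 0 < ε → 0 < δ →
      f (x + Pi.single r ε) + f (x + Pi.single s δ) ≤ f (x + Pi.single r ε + Pi.single s δ) + f x)
    (hi : Integrable fun z => f z * skewDensity A b z)
    (hi' : Integrable fun z => f z * skewDensity A' b' z) :
    ∫ z, f z * skewDensity A b z ≤ ∫ z, f z * skewDensity A' b' z := by
  rw [integral_mul_skewDensity hA b hf hi, integral_mul_skewDensity hA' b' hf hi']
  refine integral_mono_ae (integrable_gaussianPDFReal_mul_integral hA b hf hi)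
    (integrable_gaussianPDFReal_mul_integral hA' b' hf hi') ?_
  filter_upwards [ae_integrable_mul_gaussDensity hA b hf hi,
    ae_integrable_mul_gaussDensity hA' b' hf hi'] with u hu hu'
  refine mul_le_mul_of_nonneg_left ?_ (mul_nonneg zero_le_two (gaussianPDFReal_nonneg _ _ _))
  -- Equal `δ` gives both conditional laws the same shift, and `δδᵀ` cancels when their covariances
  -- are compared.
  rw [← hδ] at hu' ⊢
  refine integral_mul_gaussDensity_le (posDef_skewCov hA b) (posDef_skewCov hA' b')
    (fun i => ?_) (fun i j => ?_) ?_ hu hu'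
  · simp [skewCov, hδ, hdiag]
  · simpa [skewCov, hδ] using hle i j
  · intro x r s ε δ hrs hε hδ
    have := hsm (x + u • skewDir A b) r s ε δ hrs hε hδ
    simpa only [add_right_comm] using this

end

/-! ### First and second moments -/

section

variable {ι : Type*} [Fintype ι]

theorem abs_apply_le_sum_sq (x : ι → ℝ) (r : ι) : |x r| ≤ 1 * (1 + ∑ i, x i ^ 2) := by
  have h := Finset.single_le_sum (f := fun i => x i ^ 2) (fun i _ => sq_nonneg _)
    (Finset.mem_univ r)
  rw [abs_le]
  constructor <;> nlinarith [sq_nonneg (x r - 1), sq_nonneg (x r + 1)]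

theorem abs_apply_mul_apply_le_sum_sq (x : ι → ℝ) (r s : ι) :
    |x r * x s| ≤ 1 * (1 + ∑ i, x i ^ 2) := by
  have h := fun r => Finset.single_le_sum (f := fun i => x i ^ 2) (fun i _ => sq_nonneg _)
    (Finset.mem_univ r)
  have h1 := h r
  have h2 := h s
  rw [abs_le]
  constructor <;> nlinarith [sq_nonneg (x r - x s), sq_nonneg (x r + x s)]

variable [DecidableEq ι]

/-- The added `1` keeps the constant positive even when `ι` is empty, so that it can be divided by.
-/
theorem sum_sq_le_quadForm {A : Matrix ι ι ℝ} (hA : A.PosDef) (x : ι → ℝ) :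
    ∑ i, x i ^ 2 ≤ (∑ i, A i i + 1) * (x ⬝ᵥ A⁻¹ *ᵥ x) := by
  have h0 := hA.inv.dotProduct_mulVec_self_nonneg x
  rw [add_mul, one_mul, Finset.sum_mul]
  exact (Finset.sum_le_sum fun i _ => hA.sq_apply_le x i).trans (le_add_of_nonneg_right h0)

theorem integrable_exp_neg_quadForm {A : Matrix ι ι ℝ} (hA : A.PosDef) {c : ℝ} (hc : 0 < c) :
    Integrable fun x : ι → ℝ => Real.exp (-c * (x ⬝ᵥ A⁻¹ *ᵥ x)) := by
  have hT : 0 < ∑ i, A i i + 1 :=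
    add_pos_of_nonneg_of_pos (Finset.sum_nonneg fun i _ => hA.diag_pos.le) one_pos
  set T := ∑ i, A i i + 1
  have h1 : Integrable fun x : ι → ℝ => ∏ i, Real.exp (-(c / T) * x i ^ 2) :=
    Integrable.fintype_prod (f := fun _ (y : ℝ) => Real.exp (-(c / T) * y ^ 2))
      fun i => integrable_exp_neg_mul_sq (div_pos hc hT)
  refine h1.mono' ?_ (Eventually.of_forall fun x => ?_)
  · exact (Real.continuous_exp.comp (continuous_const.mul
      (contDiff_quadForm (n := 0) A⁻¹).continuous)).aestronglyMeasurable
  · rw [Real.norm_eq_abs, Real.abs_exp, ← Real.exp_sum, ← Finset.mul_sum]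
    refine Real.exp_le_exp.2 ?_
    rw [neg_mul, neg_mul, neg_le_neg_iff, div_mul_eq_mul_div, div_le_iff₀ hT]
    have := mul_le_mul_of_nonneg_left (sum_sq_le_quadForm hA x) hc.le
    linarith

theorem integrable_mul_gaussDensity {A : Matrix ι ι ℝ} (hA : A.PosDef) {F : (ι → ℝ) → ℝ}
    (hF : Continuous F) {C : ℝ} (hC : ∀ x, |F x| ≤ C * (1 + ∑ i, x i ^ 2)) :
    Integrable fun x => F x * gaussDensity A x := by
  have hT : 0 ≤ ∑ i, A i i := Finset.sum_nonneg fun i _ => hA.diag_pos.le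
  set T := ∑ i, A i i
  have hC0 : 0 ≤ C := by
    have := (abs_nonneg _).trans (hC 0)
    simpa using this
  set K := (√((2 * Real.pi) ^ Fintype.card ι * A.det))⁻¹ with hK
  have hK0 : 0 ≤ K := by positivity
  refine ((integrable_exp_neg_quadForm hA (c := 1 / 4) (by norm_num)).const_mul
    (C * (T + 1) * 4 * K)).mono'
    (hF.mul (continuous_gaussDensity A)).aestronglyMeasurable (Eventually.of_forall fun x => ?_)
  have hq := hA.inv.dotProduct_mulVec_self_nonneg x
  have h1 := sum_sq_le_quadForm hA x
  set q := x ⬝ᵥ A⁻¹ *ᵥ x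
  -- Quadratic growth is absorbed by `exp (q / 4)`, which leaves half of the Gaussian exponent for
  -- integrability.
  have h2 : |F x| ≤ C * (T + 1) * 4 * Real.exp (1 / 4 * q) := by
    have h3 := Real.add_one_le_exp (1 / 4 * q)
    calc |F x| ≤ C * (1 + ∑ i, x i ^ 2) := hC x
      _ ≤ C * ((T + 1) * (4 * Real.exp (1 / 4 * q))) := by
        refine mul_le_mul_of_nonneg_left ?_ hC0
        have h4 : 1 + ∑ i, x i ^ 2 ≤ (T + 1) * (1 + q) := by nlinarith
        refine h4.trans (mul_le_mul_of_nonneg_left ?_ (by positivity))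
        linarith
      _ = _ := by ring
  rw [norm_mul, Real.norm_eq_abs, Real.norm_eq_abs, abs_of_pos (gaussDensity_pos hA x),
    gaussDensity]
  calc |F x| * (K * Real.exp (-(1 / 2) * q)) ≤
      C * (T + 1) * 4 * Real.exp (1 / 4 * q) * (K * Real.exp (-(1 / 2) * q)) := by gcongr
    _ = C * (T + 1) * 4 * K * (Real.exp (1 / 4 * q) * Real.exp (-(1 / 2) * q)) := by ring
    _ = _ := by rw [← Real.exp_add]; congr 2; ring

theorem integrable_mul_skewDensity {A : Matrix ι ι ℝ} (b : ι → ℝ)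
    {F : (ι → ℝ) → ℝ} (hF : Measurable F) (hi : Integrable fun x => F x * gaussDensity A x) :
    Integrable fun x => F x * skewDensity A b x := by
  have hm : Measurable (cdf (gaussianReal 0 1)) := (monotone_cdf _).measurable
  have hb : Continuous fun x : ι → ℝ => b ⬝ᵥ x := continuous_const.dotProduct continuous_id
  refine (hi.norm.const_mul 2).mono' ?_ (Eventually.of_forall fun x => ?_)
  · exact (hF.mul (((continuous_gaussDensity A).measurable.const_mul 2).mul
      (hm.comp hb.measurable))).aestronglyMeasurable
  · rw [skewDensity, norm_mul, norm_mul, norm_mul, norm_mul, Real.norm_two, Real.norm_eq_abs (cdf _ _),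
      abs_of_nonneg (cdf_nonneg _ _)]
    calc _ ≤ ‖F x‖ * (2 * ‖gaussDensity A x‖ * 1) := by
          gcongr
          exact cdf_le_one _ _
      _ = _ := by ring

/-- Averaging over `x` and `-x` replaces the skewing factor by `1`, because `Φ(s) + Φ(-s) = 1`. -/
theorem integral_even_mul_skewDensity {A : Matrix ι ι ℝ} (b : ι → ℝ)
    {F : (ι → ℝ) → ℝ} (hF : Measurable F) (hi : Integrable fun x => F x * gaussDensity A x)
    (he : ∀ x, F (-x) = F x) :
    ∫ x, F x * skewDensity A b x = ∫ x, F x * gaussDensity A x := by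
  have h1 := integrable_mul_skewDensity b hF hi
  have h2 : ∫ x, F (-x) * skewDensity A b (-x) = ∫ x, F x * skewDensity A b x :=
    integral_neg_eq_self (fun x => F x * skewDensity A b x) _
  have h3 : (∫ x, F x * skewDensity A b x) + ∫ x, F (-x) * skewDensity A b (-x) =
      ∫ x, 2 * (F x * gaussDensity A x) := by
    rw [← integral_add h1 h1.comp_neg]
    refine integral_congr_ae (Eventually.of_forall fun x => ?_)
    have := cdf_gaussianReal_add_cdf_neg (b ⬝ᵥ x)
    simp only [skewDensity, he, gaussDensity_neg, dotProduct_neg]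
    rw [← eq_sub_iff_add_eq'] at this
    rw [this]; ring
  rw [h2, integral_const_mul] at h3
  linarith

theorem integral_apply_mul_gaussDensity {A : Matrix ι ι ℝ} (r : ι) :
    ∫ x : ι → ℝ, x r * gaussDensity A x = 0 := by
  have h := integral_neg_eq_self (fun x : ι → ℝ => x r * gaussDensity A x) volume
  simp only [gaussDensity_neg, Pi.neg_apply, neg_mul, integral_neg] at h
  linarith

theorem integrable_apply_mul_gaussDensity {A : Matrix ι ι ℝ} (hA : A.PosDef) (r : ι) :
    Integrable fun x : ι → ℝ => x r * gaussDensity A x :=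
  integrable_mul_gaussDensity hA (continuous_apply r) fun x => abs_apply_le_sum_sq x r

theorem integrable_apply_mul_apply_mul_gaussDensity {A : Matrix ι ι ℝ} (hA : A.PosDef) (r s : ι) :
    Integrable fun x : ι → ℝ => x r * x s * gaussDensity A x :=
  integrable_mul_gaussDensity hA ((continuous_apply r).mul (continuous_apply s))
    fun x => abs_apply_mul_apply_le_sum_sq x r s

theorem integrable_gaussDensity {A : Matrix ι ι ℝ} (hA : A.PosDef) :
    Integrable (gaussDensity A) := by
  have := integrable_mul_gaussDensity hA (F := fun _ => 1) continuous_const (C := 1) fun x => by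
    have : 0 ≤ ∑ i, x i ^ 2 := Finset.sum_nonneg fun i _ => sq_nonneg _
    simpa using this
  simpa using this

/-- Stein's identity: along `A e_s` the Gaussian density has derivative `-x_s` times itself and the
coordinate `x_r` has derivative `A r s`, so integration by parts gives the claim. Keeping the total
mass as a factor avoids evaluating it. -/
theorem integral_apply_mul_apply_mul_gaussDensity {A : Matrix ι ι ℝ} (hA : A.PosDef) (r s : ι) :
    ∫ x : ι → ℝ, x r * x s * gaussDensity A x = A r s * ∫ x, gaussDensity A x := by
  set v : ι → ℝ := A *ᵥ Pi.single s 1 with hv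
  have hg : ContDiff ℝ 1 (gaussDensity A) :=
    contDiff_const.mul (Real.contDiff_exp.comp (contDiff_const.mul (contDiff_quadForm A⁻¹)))
  have hd : ∀ x, fderiv ℝ (gaussDensity A) x v = -(x s * gaussDensity A x) := by
    intro x
    rw [← ((hg.differentiable one_ne_zero) x).lineDeriv_eq_fderiv]
    refine HasLineDerivAt.lineDeriv ?_
    have hG : Differentiable ℝ fun q : ℝ =>
      (√((2 * Real.pi) ^ Fintype.card ι * A.det))⁻¹ * Real.exp (-(1 / 2) * q) := by fun_prop
    have h1 := HasLineDerivAt.comp_deriv hG (hasLineDerivAt_quadForm hA.inv.isSymm x v)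
    have h2 : v ⬝ᵥ A⁻¹ *ᵥ x = x s := by
      rw [hv, dotProduct_comm, dotProduct_mulVec_comm_of_isSymm hA.isSymm, hA.mulVec_inv_mulVec,
        single_one_dotProduct]
    refine HasDerivAt.congr_deriv h1 ?_
    have h3 : deriv (fun q : ℝ =>
        (√((2 * Real.pi) ^ Fintype.card ι * A.det))⁻¹ * Real.exp (-(1 / 2) * q))
        (x ⬝ᵥ A⁻¹ *ᵥ x) = -(1 / 2) * gaussDensity A x := by
      have h4 : HasDerivAt (fun q : ℝ => -(1 / 2) * q) (-(1 / 2)) (x ⬝ᵥ A⁻¹ *ᵥ x) := by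
        simpa using (hasDerivAt_id (x ⬝ᵥ A⁻¹ *ᵥ x)).const_mul (-(1 / 2) : ℝ)
      rw [(h4.exp.const_mul _).deriv, gaussDensity]
      ring
    rw [h3, h2]
    ring
  have hp : ∀ x : ι → ℝ, fderiv ℝ (fun x : ι → ℝ => x r) x v = A r s := by
    intro x
    have : (fun x : ι → ℝ => x r) = ContinuousLinearMap.proj (R := ℝ) (φ := fun _ : ι => ℝ) r := rfl
    rw [this, ContinuousLinearMap.fderiv]
    simp [hv]
  have key := integral_mul_fderiv_eq_neg_fderiv_mul_of_integrable (μ := volume)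
    (f := fun x : ι → ℝ => x r) (g := gaussDensity A) (v := v) ?_ ?_ ?_
    (fun x _ => by fun_prop) (fun x _ => hg.differentiable one_ne_zero x)
  · simp only [hd, hp, mul_neg, integral_neg, neg_inj, integral_const_mul] at key
    simpa [mul_assoc] using key
  · simp only [hp]
    exact (integrable_gaussDensity hA).const_mul _
  · simp only [hd, mul_neg]
    simpa [mul_assoc] using (integrable_apply_mul_apply_mul_gaussDensity hA r s).neg
  · exact integrable_apply_mul_gaussDensity hA r

theorem integral_apply_mul_apply_mul_skewDensity {A : Matrix ι ι ℝ} (hA : A.PosDef) {b : ι → ℝ}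
    (h1 : ∫ x, skewDensity A b x = 1) (r s : ι) :
    ∫ x : ι → ℝ, x r * x s * skewDensity A b x = A r s := by
  have h2 := integral_even_mul_skewDensity b (F := fun _ => 1) measurable_const
    (by simpa using integrable_gaussDensity hA) fun _ => rfl
  simp only [one_mul, h1] at h2
  rw [integral_even_mul_skewDensity b (F := fun x => x r * x s)
    ((measurable_pi_apply r).mul (measurable_pi_apply s))
    (integrable_apply_mul_apply_mul_gaussDensity hA r s) (fun x => by simp),
    integral_apply_mul_apply_mul_gaussDensity hA, ← h2, mul_one]

theorem integrable_mul_gaussianPDFReal : Integrable fun u => gaussianPDFReal 0 1 u * u := by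
  have := (integrable_mul_exp_neg_mul_sq (b := 1 / 2) (by norm_num)).const_mul
    (√(2 * Real.pi))⁻¹
  refine this.congr (Eventually.of_forall fun u => ?_)
  simp only [gaussianPDFReal_zero_one]
  ring

theorem integral_Ioi_mul_gaussianPDFReal_pos :
    0 < ∫ u in Set.Ioi (0 : ℝ), gaussianPDFReal 0 1 u * u := by
  rw [setIntegral_pos_iff_support_of_nonneg_ae]
  · have : Function.support (fun u => gaussianPDFReal 0 1 u * u) ∩ Set.Ioi 0 = Set.Ioi 0 := by
      refine Set.inter_eq_right.2 fun u hu => ?_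
      exact mul_ne_zero (gaussianPDFReal_pos 0 1 u one_ne_zero).ne' (ne_of_gt hu)
    rw [this]
    simp
  · filter_upwards [ae_restrict_mem measurableSet_Ioi] with u hu
    exact mul_nonneg (gaussianPDFReal_nonneg _ _ _) (le_of_lt hu)
  · exact integrable_mul_gaussianPDFReal.integrableOn

/-- The mean of a standardized skew-normal vector is a universal multiple of `δ`. -/
theorem integral_apply_mul_skewDensity {A : Matrix ι ι ℝ} (hA : A.PosDef) {b : ι → ℝ}
    (h1 : ∫ x, skewDensity A b x = 1) (r : ι) :
    ∫ x : ι → ℝ, x r * skewDensity A b x =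
      (∫ u in Set.Ioi (0 : ℝ), gaussianPDFReal 0 1 u)⁻¹ *
        (∫ u in Set.Ioi (0 : ℝ), gaussianPDFReal 0 1 u * u) * skewDir A b r := by
  set m := ∫ w, gaussDensity (skewCov A b) w with hm
  have hΓ := posDef_skewCov hA b
  -- The mixture formula for the constant function `1` fixes the normalization of `m`.
  have e1 : 1 = 2 * (∫ u in Set.Ioi (0 : ℝ), gaussianPDFReal 0 1 u) * m := by
    have h2 := integral_mul_skewDensity hA b (f := fun _ => 1) measurable_const
      (integrable_mul_skewDensity b measurable_const
        (by simpa using integrable_gaussDensity hA))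
    simp only [one_mul, h1, ← hm] at h2
    rw [h2, integral_mul_const, integral_const_mul]
  have e2 : ∀ u : ℝ, ∫ w : ι → ℝ, (w + u • skewDir A b) r * gaussDensity (skewCov A b) w =
      u * skewDir A b r * m := by
    intro u
    simp only [Pi.add_apply, Pi.smul_apply, smul_eq_mul, add_mul]
    rw [integral_add (integrable_apply_mul_gaussDensity hΓ r)
      ((integrable_gaussDensity hΓ).const_mul _), integral_apply_mul_gaussDensity, zero_add,
      integral_const_mul]
  have e3 := integral_mul_skewDensity hA b (f := fun z => z r) (measurable_pi_apply r)
    (integrable_mul_skewDensity b (measurable_pi_apply r)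
      (integrable_apply_mul_gaussDensity hA r))
  rw [e3]
  simp_rw [e2]
  have e4 : ∀ u : ℝ, 2 * gaussianPDFReal 0 1 u * (u * skewDir A b r * m) =
      (2 * skewDir A b r * m) * (gaussianPDFReal 0 1 u * u) := fun u => by ring
  simp_rw [e4]
  rw [integral_const_mul]
  have h5 : ∫ u in Set.Ioi (0 : ℝ), gaussianPDFReal 0 1 u ≠ 0 := by
    intro h; rw [h] at e1; simp at e1
  have h6 : m = (2 * ∫ u in Set.Ioi (0 : ℝ), gaussianPDFReal 0 1 u)⁻¹ :=
    eq_inv_of_mul_eq_one_right e1.symm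
  rw [h6]
  field_simp

theorem skewDir_eq_of_integral_eq {A A' : Matrix ι ι ℝ} (hA : A.PosDef) (hA' : A'.PosDef)
    {b b' : ι → ℝ} (h1 : ∫ x, skewDensity A b x = 1) (h1' : ∫ x, skewDensity A' b' x = 1)
    (h : ∀ r, ∫ x : ι → ℝ, x r * skewDensity A b x = ∫ x : ι → ℝ, x r * skewDensity A' b' x) :
    skewDir A b = skewDir A' b' := by
  funext r
  have h2 := h r
  rw [integral_apply_mul_skewDensity hA h1, integral_apply_mul_skewDensity hA' h1'] at h2
  refine mul_left_cancel₀ (mul_ne_zero (inv_ne_zero ?_) integral_Ioi_mul_gaussianPDFReal_pos.ne') h2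
  -- The half-line mass is `Φ(0)`, which is nonzero because `2 Φ(0) = 1`.
  have h3 := integral_Ioi_gaussianPDFReal_mul_sub one_pos 0
  simp only [one_mul, sub_zero] at h3
  have h4 := cdf_gaussianReal_add_cdf_neg 0
  rw [neg_zero] at h4
  rw [h3]
  intro h5
  rw [h5] at h4
  norm_num at h4

end

theorem measurable_skewDensity {ι : Type*} [Fintype ι] [DecidableEq ι] (A : Matrix ι ι ℝ)
    (b : ι → ℝ) : Measurable (skewDensity A b) := by
  have hm : Measurable (cdf (gaussianReal 0 1)) := (monotone_cdf _).measurable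
  have hb : Continuous fun x : ι → ℝ => b ⬝ᵥ x := continuous_const.dotProduct continuous_id
  exact ((continuous_gaussDensity A).measurable.const_mul 2).mul (hm.comp hb.measurable)

/-! ### Correlation matrices and vectorization -/

section CorrMatrix

variable {m : ℕ}

theorem inv_sdMatrix {A : Matrix (Fin m) (Fin m) ℝ} (hA : ∀ i, 0 < A i i) :
    (sdMatrix A)⁻¹ = Matrix.diagonal fun i => (√(A i i))⁻¹ := by
  refine Matrix.inv_eq_right_inv ?_
  rw [sdMatrix, Matrix.diagonal_mul_diagonal, ← Matrix.diagonal_one]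
  congr 1
  funext i
  exact mul_inv_cancel₀ (Real.sqrt_ne_zero'.2 (hA i))

theorem corrMatrix_apply {A : Matrix (Fin m) (Fin m) ℝ} (hA : ∀ i, 0 < A i i) (i j : Fin m) :
    corrMatrix A i j = (√(A i i))⁻¹ * A i j * (√(A j j))⁻¹ := by
  rw [corrMatrix, inv_sdMatrix hA, Matrix.mul_diagonal, Matrix.diagonal_mul]

theorem corrMatrix_apply_self {A : Matrix (Fin m) (Fin m) ℝ} (hA : A.PosDef) (i : Fin m) :
    corrMatrix A i i = 1 := by
  have h := hA.diag_pos (i := i)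
  rw [corrMatrix_apply fun i => hA.diag_pos]
  have h1 : √(A i i) ≠ 0 := Real.sqrt_ne_zero'.2 h
  have h2 := Real.mul_self_sqrt h.le
  field_simp
  rw [sq, h2]

/-- In the standardized case `ω` is therefore the identity and drops out of the density and of `δ`.
-/
theorem sdMatrix_corrMatrix {A : Matrix (Fin m) (Fin m) ℝ} (hA : A.PosDef) :
    sdMatrix (corrMatrix A) = 1 := by
  rw [sdMatrix, ← Matrix.diagonal_one]
  congr 1
  funext i
  rw [corrMatrix_apply_self hA, Real.sqrt_one]

theorem corrMatrix_corrMatrix {A : Matrix (Fin m) (Fin m) ℝ} (hA : A.PosDef) :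
    corrMatrix (corrMatrix A) = corrMatrix A := by
  conv_lhs => rw [corrMatrix, sdMatrix_corrMatrix hA]
  simp

theorem posDef_corrMatrix {A : Matrix (Fin m) (Fin m) ℝ} (hA : A.PosDef) :
    (corrMatrix A).PosDef := by
  have h := hA.mul_mul_conjTranspose_same (B := (sdMatrix A)⁻¹) ?_
  · have e : ((sdMatrix A)⁻¹)ᴴ = (sdMatrix A)⁻¹ := by
      rw [inv_sdMatrix fun i => hA.diag_pos, Matrix.diagonal_conjTranspose]
      congr 1
    rwa [e] at h
  · refine Matrix.vecMul_injective_of_isUnit ?_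
    rw [Matrix.isUnit_iff_isUnit_det, inv_sdMatrix fun i => hA.diag_pos, Matrix.det_diagonal]
    exact (Finset.prod_ne_zero_iff.2 fun i _ =>
      inv_ne_zero (Real.sqrt_ne_zero'.2 hA.diag_pos)).isUnit

end CorrMatrix

variable {n p : ℕ}

/-- Column-stacking vectorization as a measurable equivalence. -/
def vecEquiv (n p : ℕ) : Mat n p ≃ᵐ (Fin p × Fin n → ℝ) where
  toFun := vecM
  invFun z i j := z (j, i)
  left_inv _ := rfl
  right_inv _ := rfl
  measurable_toFun := measurable_pi_lambda _ fun r =>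
    (measurable_pi_apply r.1).comp (measurable_pi_apply r.2)
  measurable_invFun := measurable_pi_lambda _ fun i => measurable_pi_lambda _ fun j =>
    measurable_pi_apply (j, i)

theorem vecEquiv_symm_apply (z : Fin p × Fin n → ℝ) (i : Fin n) (j : Fin p) :
    (vecEquiv n p).symm z i j = z (j, i) := rfl

theorem measurePreserving_vecEquiv :
    MeasurePreserving (vecEquiv n p) (volume : Measure (Mat n p)) volume := by
  refine ⟨(vecEquiv n p).measurable, ?_⟩
  refine (Measure.pi_eq fun s hs => ?_).symm
  rw [MeasurableEquiv.map_apply]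
  have : (vecEquiv n p) ⁻¹' Set.univ.pi s =
      Set.univ.pi fun i => Set.univ.pi fun j => s (j, i) := by
    ext Y
    simp only [Set.mem_preimage, Set.mem_univ_pi, Prod.forall]
    exact ⟨fun h i j => h j i, fun h j i => h i j⟩
  rw [this, volume_pi_pi]
  simp_rw [volume_pi_pi]
  rw [Fintype.prod_prod_type_right]

theorem matrixSkewNormalPDF_eq_skewDensity {V : Matrix (Fin p) (Fin p) ℝ}
    {S : Matrix (Fin n) (Fin n) ℝ} (hV : V.PosDef) (hS : S.PosDef) (B Y : Mat n p) :
    matrixSkewNormalPDF 0 (corrMatrix V) (corrMatrix S) B Y =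
      skewDensity (corrMatrix V ⊗ₖ corrMatrix S) (vecM B) (vecM Y) := by
  rw [matrixSkewNormalPDF, matrixNormalPDF, skewDensity, gaussDensity, sdMatrix_corrMatrix hV,
    sdMatrix_corrMatrix hS, sub_zero, Matrix.one_kronecker_one, inv_one, Matrix.one_mulVec,
    Fintype.card_prod, Fintype.card_fin, Fintype.card_fin, mul_comm p n]

theorem skewDelta_eq_skewDir {V : Matrix (Fin p) (Fin p) ℝ} {S : Matrix (Fin n) (Fin n) ℝ}
    (hV : V.PosDef) (hS : S.PosDef) (B : Mat n p) :
    skewDelta (corrMatrix V) (corrMatrix S) B =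
      skewDir (corrMatrix V ⊗ₖ corrMatrix S) (vecM B) := by
  rw [skewDelta, skewDir, skewScale, sdMatrix_corrMatrix hV, sdMatrix_corrMatrix hS,
    Matrix.one_kronecker_one, inv_one, Matrix.one_mulVec, corrMatrix_corrMatrix hV,
    corrMatrix_corrMatrix hS]

/-! ### From random matrices to integrals against the skew-normal density -/

section Law

variable {V : Matrix (Fin p) (Fin p) ℝ} {S : Matrix (Fin n) (Fin n) ℝ} {B : Mat n p}
  {Ω : Type*} [MeasurableSpace Ω] {P : Measure Ω} {X : Ω → Mat n p}

theorem measurable_matrixSkewNormalPDF (hV : V.PosDef) (hS : S.PosDef) :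
    Measurable (matrixSkewNormalPDF 0 (corrMatrix V) (corrMatrix S) B) := by
  have : matrixSkewNormalPDF 0 (corrMatrix V) (corrMatrix S) B =
      skewDensity (corrMatrix V ⊗ₖ corrMatrix S) (vecM B) ∘ vecEquiv n p :=
    funext fun Y => matrixSkewNormalPDF_eq_skewDensity hV hS B Y
  rw [this]
  exact (measurable_skewDensity _ _).comp (vecEquiv n p).measurable

theorem integrable_comp_iff_of_hasLaw (hV : V.PosDef) (hS : S.PosDef)
    (hX : HasLaw X (matrixSkewNormal 0 (corrMatrix V) (corrMatrix S) B) P)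
    {f : Mat n p → ℝ} (hf : Measurable f) :
    Integrable (fun w => f (X w)) P ↔
      Integrable fun z => f ((vecEquiv n p).symm z) *
        skewDensity (corrMatrix V ⊗ₖ corrMatrix S) (vecM B) z := by
  have h1 : Integrable f (P.map X) ↔ Integrable (f ∘ X) P :=
    integrable_map_measure hf.aestronglyMeasurable hX.aemeasurable
  rw [hX.map_eq, matrixSkewNormal, integrable_withDensity_iff
    (measurable_matrixSkewNormalPDF hV hS).ennreal_ofReal
    (Eventually.of_forall fun _ => ENNReal.ofReal_lt_top)] at h1
  refine h1.symm.trans ?_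
  rw [← measurePreserving_vecEquiv.integrable_comp_emb (vecEquiv n p).measurableEmbedding]
  refine integrable_congr (Eventually.of_forall fun Y => ?_)
  have h0 := skewDensity_nonneg ((posDef_corrMatrix hV).kronecker (posDef_corrMatrix hS))
    (vecM B) (vecM Y)
  simp only [Function.comp, MeasurableEquiv.symm_apply_apply]
  rw [matrixSkewNormalPDF_eq_skewDensity hV hS, ENNReal.toReal_ofReal h0]
  rfl

theorem integral_comp_of_hasLaw (hV : V.PosDef) (hS : S.PosDef)
    (hX : HasLaw X (matrixSkewNormal 0 (corrMatrix V) (corrMatrix S) B) P)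
    {f : Mat n p → ℝ} (hf : Measurable f) :
    ∫ w, f (X w) ∂P = ∫ z, f ((vecEquiv n p).symm z) *
        skewDensity (corrMatrix V ⊗ₖ corrMatrix S) (vecM B) z := by
  have h1 : ∫ y, f y ∂(P.map X) = ∫ w, f (X w) ∂P :=
    integral_map hX.aemeasurable hf.aestronglyMeasurable
  rw [hX.map_eq, matrixSkewNormal, integral_withDensity_eq_integral_toReal_smul
    (measurable_matrixSkewNormalPDF hV hS).ennreal_ofReal
    (Eventually.of_forall fun _ => ENNReal.ofReal_lt_top)] at h1
  rw [← h1, ← measurePreserving_vecEquiv.integral_comp (vecEquiv n p).measurableEmbedding]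
  refine integral_congr_ae (Eventually.of_forall fun Y => ?_)
  have h0 := skewDensity_nonneg ((posDef_corrMatrix hV).kronecker (posDef_corrMatrix hS))
    (vecM B) (vecM Y)
  simp only [MeasurableEquiv.symm_apply_apply, smul_eq_mul]
  rw [matrixSkewNormalPDF_eq_skewDensity hV hS, ENNReal.toReal_ofReal h0, mul_comm]
  rfl

/-- The normalization is read off from `P` being a probability measure; no Gaussian integral has to
be computed. -/
theorem integral_skewDensity_of_hasLaw [IsProbabilityMeasure P] (hV : V.PosDef) (hS : S.PosDef)
    (hX : HasLaw X (matrixSkewNormal 0 (corrMatrix V) (corrMatrix S) B) P) :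
    ∫ z, skewDensity (corrMatrix V ⊗ₖ corrMatrix S) (vecM B) z = 1 := by
  have := integral_comp_of_hasLaw hV hS hX (f := fun _ => 1) measurable_const
  simpa using this.symm

theorem measurable_entry (i : Fin n) (j : Fin p) : Measurable fun Y : Mat n p => Y i j :=
  (measurable_pi_apply j).comp (measurable_pi_apply i)

theorem integrable_entry_mul_entry (hV : V.PosDef) (hS : S.PosDef)
    (hX : HasLaw X (matrixSkewNormal 0 (corrMatrix V) (corrMatrix S) B) P)
    (r s : Fin p × Fin n) : Integrable (fun w => X w r.2 r.1 * X w s.2 s.1) P := by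
  refine (integrable_comp_iff_of_hasLaw hV hS hX (f := fun Y => Y r.2 r.1 * Y s.2 s.1)
    ((measurable_entry _ _).mul (measurable_entry _ _))).2 ?_
  exact integrable_mul_skewDensity _ ((measurable_pi_apply r).mul (measurable_pi_apply s))
    (integrable_apply_mul_apply_mul_gaussDensity
      ((posDef_corrMatrix hV).kronecker (posDef_corrMatrix hS)) r s)

theorem integral_entry_mul_entry [IsProbabilityMeasure P] (hV : V.PosDef) (hS : S.PosDef)
    (hX : HasLaw X (matrixSkewNormal 0 (corrMatrix V) (corrMatrix S) B) P)
    (r s : Fin p × Fin n) :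
    ∫ w, X w r.2 r.1 * X w s.2 s.1 ∂P = (corrMatrix V ⊗ₖ corrMatrix S) r s := by
  rw [integral_comp_of_hasLaw hV hS hX (f := fun Y => Y r.2 r.1 * Y s.2 s.1)
    ((measurable_entry _ _).mul (measurable_entry _ _))]
  exact integral_apply_mul_apply_mul_skewDensity
      ((posDef_corrMatrix hV).kronecker (posDef_corrMatrix hS))
      (integral_skewDensity_of_hasLaw hV hS hX) r s

end Law

/-! ### Supermodular test functions -/

section Supermodular

theorem diffOp_diffOp (k l : Fin n) (i j : Fin p) (ε δ : ℝ) (f : Mat n p → ℝ) (X : Mat n p) :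
    diffOp k i ε (diffOp l j δ f) X =
      f (X + Pi.single k (Pi.single i ε) + Pi.single l (Pi.single j δ)) -
        f (X + Pi.single k (Pi.single i ε)) -
        (f (X + Pi.single l (Pi.single j δ)) - f X) := rfl

theorem single_single_apply (k a : Fin n) (i b : Fin p) (ε : ℝ) :
    (Pi.single k (Pi.single i ε) : Mat n p) a b = if (a, b) = (k, i) then ε else 0 := by
  by_cases h : a = k
  · subst h
    by_cases h' : b = i
    · subst h'; simp
    · simp [h']
  · simp [h]

/-- Of two distinct positions at most one touches the entry `(a, b)`, so the mixed difference
vanishes. As `h` is arbitrary, `-h` is covered too. -/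
theorem isSupermodular_entry (h : ℝ → ℝ) (a : Fin n) (b : Fin p) :
    IsSupermodular fun X : Mat n p => h (X a b) := by
  intro X k l i j hne ε δ _ _
  rw [diffOp_diffOp]
  simp only [Pi.add_apply, single_single_apply]
  by_cases h1 : (a, b) = (k, i)
  · rw [if_neg (c := (a, b) = (l, j)) (h1 ▸ hne)]
    simp
  · rw [if_neg h1]
    simp

/-- The mixed difference is a sum of two products of nonnegative increments. -/
theorem isSupermodular_entry_mul_entry (a c : Fin n) (b d : Fin p) :
    IsSupermodular fun X : Mat n p => X a b * X c d := by
  intro X k l i j _ ε δ hε hδ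
  rw [diffOp_diffOp]
  simp only [Pi.add_apply, single_single_apply]
  have h1 : ∀ (P : Prop) [Decidable P], 0 ≤ if P then ε else 0 := fun P _ => by
    split_ifs <;> positivity
  have h2 : ∀ (P : Prop) [Decidable P], 0 ≤ if P then δ else 0 := fun P _ => by
    split_ifs <;> positivity
  have h3 := mul_nonneg (h1 ((a, b) = (k, i))) (h2 ((c, d) = (l, j)))
  have h4 := mul_nonneg (h2 ((a, b) = (l, j))) (h1 ((c, d) = (k, i)))
  linarith

theorem twiceDifferentiable_of_contDiff {f : Mat n p → ℝ} (hf : ContDiff ℝ 2 f) :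
    TwiceDifferentiable f :=
  ⟨hf.differentiable two_ne_zero,
    (hf.fderiv_right (m := 1) (by norm_num)).differentiable one_ne_zero⟩

theorem contDiff_entry (a : Fin n) (b : Fin p) : ContDiff ℝ 2 fun X : Mat n p => X a b := by
  fun_prop

theorem IsSupermodular.comp_vecEquiv_symm {f : Mat n p → ℝ} (hf : IsSupermodular f)
    (x : Fin p × Fin n → ℝ) (r s : Fin p × Fin n) (ε δ : ℝ) (hrs : r ≠ s) (hε : 0 < ε)
    (hδ : 0 < δ) :
    f ((vecEquiv n p).symm (x + Pi.single r ε)) + f ((vecEquiv n p).symm (x + Pi.single s δ)) ≤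
      f ((vecEquiv n p).symm (x + Pi.single r ε + Pi.single s δ)) +
        f ((vecEquiv n p).symm x) := by
  have e : ∀ (y : Fin p × Fin n → ℝ) (r : Fin p × Fin n) (ε : ℝ),
      (vecEquiv n p).symm (y + Pi.single r ε) =
        (vecEquiv n p).symm y + Pi.single r.2 (Pi.single r.1 ε) := by
    intro y r ε
    funext i j
    rw [vecEquiv_symm_apply, Pi.add_apply, Pi.add_apply, Pi.add_apply, vecEquiv_symm_apply,
      single_single_apply, Pi.single_apply]
    congr 1
    refine if_congr ?_ rfl rfl
    rw [Prod.ext_iff, Prod.ext_iff]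
    exact and_comm
  have hne : (r.2, r.1) ≠ (s.2, s.1) := fun h => hrs <| by
    rw [Prod.ext_iff] at h ⊢
    exact and_comm.1 h
  have := hf ((vecEquiv n p).symm x) r.2 s.2 r.1 s.1 hne ε δ hε hδ
  rw [diffOp_diffOp] at this
  rw [e, e, e, e]
  linarith

end Supermodular

/-! ### The two implications -/

section Order

variable {Ω Ω' : Type*} [MeasurableSpace Ω] [MeasurableSpace Ω'] {P : Measure Ω}
  {P' : Measure Ω'} {X : Ω → Mat n p} {Y : Ω' → Mat n p}

theorem SupermodularOrder.smooth (h : SupermodularOrder P P' X Y) :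
    SmoothSupermodularOrder P P' X Y :=
  fun f hf => h f hf.1

/-- Both `g` and `-g` of an entry are admissible test functions, so the order inequality holds in
both directions. -/
theorem SmoothSupermodularOrder.integral_comp_entry_eq [IsProbabilityMeasure P]
    [IsProbabilityMeasure P'] (h : SmoothSupermodularOrder P P' X Y) (hX : AEMeasurable X P)
    (hY : AEMeasurable Y P') {g : ℝ → ℝ} (hg : ContDiff ℝ 2 g) (hb : ∀ x, |g x| ≤ 1)
    (i : Fin n) (j : Fin p) : ∫ w, g (X w i j) ∂P = ∫ w, g (Y w i j) ∂P' := by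
  have hm : Measurable fun Z : Mat n p => g (Z i j) :=
    hg.continuous.measurable.comp (measurable_entry i j)
  have hiX : Integrable (fun w => g (X w i j)) P :=
    (integrable_const (1 : ℝ)).mono' (hm.comp_aemeasurable hX).aestronglyMeasurable
      (Eventually.of_forall fun w => hb _)
  have hiY : Integrable (fun w => g (Y w i j)) P' :=
    (integrable_const (1 : ℝ)).mono' (hm.comp_aemeasurable hY).aestronglyMeasurable
      (Eventually.of_forall fun w => hb _)
  have hd := hg.comp (contDiff_entry i j)
  refine le_antisymm (h _ ⟨isSupermodular_entry g i j, twiceDifferentiable_of_contDiff hd⟩ hm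
    hiX hiY) ?_
  have := h _ ⟨isSupermodular_entry (fun x => -g x) i j, twiceDifferentiable_of_contDiff hd.neg⟩
    hm.neg hiX.neg hiY.neg
  simpa [integral_neg] using this

theorem charFun_map_eq_integral_cos_add {P : Measure Ω} [IsProbabilityMeasure P] {Z : Ω → ℝ}
    (hZ : AEMeasurable Z P) (t : ℝ) : charFun (P.map Z) t =
      ((∫ w, Real.cos (t * Z w) ∂P : ℝ) : ℂ) +
        ((∫ w, Real.sin (t * Z w) ∂P : ℝ) : ℂ) * Complex.I := by
  have hc : Integrable (fun w => Real.cos (t * Z w)) P :=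
    (integrable_const (1 : ℝ)).mono'
      (Real.measurable_cos.comp_aemeasurable (hZ.const_mul t)).aestronglyMeasurable
      (Eventually.of_forall fun w => Real.abs_cos_le_one _)
  have hs : Integrable (fun w => Real.sin (t * Z w)) P :=
    (integrable_const (1 : ℝ)).mono'
      (Real.measurable_sin.comp_aemeasurable (hZ.const_mul t)).aestronglyMeasurable
      (Eventually.of_forall fun w => Real.abs_sin_le_one _)
  rw [charFun_apply_real, integral_map hZ (by fun_prop), ← integral_complex_ofReal,
    ← integral_complex_ofReal, ← integral_mul_const, ← integral_add hc.ofReal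
      (hs.ofReal.mul_const _)]
  refine integral_congr_ae (Eventually.of_forall fun w => ?_)
  simp only
  rw [← Complex.ofReal_mul, Complex.exp_mul_I, Complex.ofReal_cos, Complex.ofReal_sin]

/-- Cosines and sines are smooth and bounded by one, and they determine the characteristic function
of each entry. -/
theorem SmoothSupermodularOrder.sameMarginals [IsProbabilityMeasure P]
    [IsProbabilityMeasure P'] (h : SmoothSupermodularOrder P P' X Y) (hX : AEMeasurable X P)
    (hY : AEMeasurable Y P') : SameMarginals P P' X Y := by
  intro i j
  have hXm : AEMeasurable (fun w => X w i j) P := (measurable_entry i j).comp_aemeasurable hX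
  have hYm : AEMeasurable (fun w => Y w i j) P' := (measurable_entry i j).comp_aemeasurable hY
  refine ⟨hXm, hYm, ?_⟩
  have := Measure.isProbabilityMeasure_map hXm
  have := Measure.isProbabilityMeasure_map hYm
  refine Measure.ext_of_charFun ?_
  funext t
  rw [charFun_map_eq_integral_cos_add hXm, charFun_map_eq_integral_cos_add hYm,
    h.integral_comp_entry_eq hX hY (g := fun x => Real.cos (t * x)) (by fun_prop)
      (fun x => Real.abs_cos_le_one _),
    h.integral_comp_entry_eq hX hY (g := fun x => Real.sin (t * x)) (by fun_prop)
      (fun x => Real.abs_sin_le_one _)]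

variable {V V' : Matrix (Fin p) (Fin p) ℝ} {S S' : Matrix (Fin n) (Fin n) ℝ} {B B' : Mat n p}
  [IsProbabilityMeasure P] [IsProbabilityMeasure P']

theorem SmoothSupermodularOrder.corrMatrix_le (h : SmoothSupermodularOrder P P' X Y)
    (hV : V.PosDef) (hS : S.PosDef) (hV' : V'.PosDef) (hS' : S'.PosDef)
    (hX : HasLaw X (matrixSkewNormal 0 (corrMatrix V) (corrMatrix S) B) P)
    (hY : HasLaw Y (matrixSkewNormal 0 (corrMatrix V') (corrMatrix S') B') P')
    (r s : Fin p × Fin n) :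
    (corrMatrix V ⊗ₖ corrMatrix S) r s ≤ (corrMatrix V' ⊗ₖ corrMatrix S') r s := by
  rw [← integral_entry_mul_entry hV hS hX, ← integral_entry_mul_entry hV' hS' hY]
  exact h _ ⟨isSupermodular_entry_mul_entry _ _ _ _,
    twiceDifferentiable_of_contDiff ((contDiff_entry _ _).mul (contDiff_entry _ _))⟩
    ((measurable_entry _ _).mul (measurable_entry _ _))
    (integrable_entry_mul_entry hV hS hX r s) (integrable_entry_mul_entry hV' hS' hY r s)

/-- Equal marginals have equal means, and the mean vector determines `δ`. -/
theorem SameMarginals.skewDir_eq (h : SameMarginals P P' X Y)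
    (hV : V.PosDef) (hS : S.PosDef) (hV' : V'.PosDef) (hS' : S'.PosDef)
    (hX : HasLaw X (matrixSkewNormal 0 (corrMatrix V) (corrMatrix S) B) P)
    (hY : HasLaw Y (matrixSkewNormal 0 (corrMatrix V') (corrMatrix S') B') P') :
    skewDir (corrMatrix V ⊗ₖ corrMatrix S) (vecM B) =
      skewDir (corrMatrix V' ⊗ₖ corrMatrix S') (vecM B') := by
  refine skewDir_eq_of_integral_eq ((posDef_corrMatrix hV).kronecker (posDef_corrMatrix hS))
    ((posDef_corrMatrix hV').kronecker (posDef_corrMatrix hS'))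
    (integral_skewDensity_of_hasLaw hV hS hX) (integral_skewDensity_of_hasLaw hV' hS' hY)
    fun r => ?_
  have h1 := integral_comp_of_hasLaw hV hS hX (measurable_entry r.2 r.1)
  have h2 := integral_comp_of_hasLaw hV' hS' hY (measurable_entry r.2 r.1)
  exact h1.symm.trans ((h r.2 r.1).integral_eq.trans h2)

theorem SameMarginals.supermodularOrder (h : SameMarginals P P' X Y)
    (hV : V.PosDef) (hS : S.PosDef) (hV' : V'.PosDef) (hS' : S'.PosDef)
    (hX : HasLaw X (matrixSkewNormal 0 (corrMatrix V) (corrMatrix S) B) P)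
    (hY : HasLaw Y (matrixSkewNormal 0 (corrMatrix V') (corrMatrix S') B') P')
    (hle : ∀ r s : Fin p × Fin n,
      (corrMatrix V ⊗ₖ corrMatrix S) r s ≤ (corrMatrix V' ⊗ₖ corrMatrix S') r s) :
    SupermodularOrder P P' X Y := by
  intro f hf hm hiX hiY
  rw [integral_comp_of_hasLaw hV hS hX hm, integral_comp_of_hasLaw hV' hS' hY hm]
  refine integral_mul_skewDensity_le ((posDef_corrMatrix hV).kronecker (posDef_corrMatrix hS))
    ((posDef_corrMatrix hV').kronecker (posDef_corrMatrix hS'))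
    (h.skewDir_eq hV hS hV' hS' hX hY) (fun r => ?_) hle
    (f := fun z => f ((vecEquiv n p).symm z)) (hm.comp (vecEquiv n p).symm.measurable)
    (IsSupermodular.comp_vecEquiv_symm hf)
    ((integrable_comp_iff_of_hasLaw hV hS hX hm).1 hiX)
    ((integrable_comp_iff_of_hasLaw hV' hS' hY hm).1 hiY)
  -- Both dispersion matrices have unit diagonal, so the equal-variance condition is automatic.
  rw [Matrix.kronecker_apply, Matrix.kronecker_apply, corrMatrix_apply_self hV,
    corrMatrix_apply_self hS, corrMatrix_apply_self hV', corrMatrix_apply_self hS']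

end Order

end SkewNormal

end

theorem mainTheorem7 {n p : ℕ}
    (V V' : Matrix (Fin p) (Fin p) ℝ) (S S' : Matrix (Fin n) (Fin n) ℝ)
    (hV : V.PosDef) (hV' : V'.PosDef) (hS : S.PosDef) (hS' : S'.PosDef)
    (B B' : SkewNormal.Mat n p)
    {Ω Ω' : Type*} [MeasurableSpace Ω] [MeasurableSpace Ω']
    (P : Measure Ω) (P' : Measure Ω') [IsProbabilityMeasure P] [IsProbabilityMeasure P']
    (X₀ : Ω → SkewNormal.Mat n p) (Y₀ : Ω' → SkewNormal.Mat n p)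
    (hX₀ : HasLaw X₀ (SkewNormal.matrixSkewNormal 0 (SkewNormal.corrMatrix V)
      (SkewNormal.corrMatrix S) B) P)
    (hY₀ : HasLaw Y₀ (SkewNormal.matrixSkewNormal 0 (SkewNormal.corrMatrix V')
      (SkewNormal.corrMatrix S') B') P') :
    (SkewNormal.SupermodularOrder P P' X₀ Y₀ ↔
      (SkewNormal.SameMarginals P P' X₀ Y₀ ∧
        ∀ r s : Fin p × Fin n,
          (SkewNormal.corrMatrix V ⊗ₖ SkewNormal.corrMatrix S) r s ≤
            (SkewNormal.corrMatrix V' ⊗ₖ SkewNormal.corrMatrix S') r s)) ∧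
    (SkewNormal.SmoothSupermodularOrder P P' X₀ Y₀ ↔
      (SkewNormal.SameMarginals P P' X₀ Y₀ ∧
        ∀ r s : Fin p × Fin n,
          (SkewNormal.corrMatrix V ⊗ₖ SkewNormal.corrMatrix S) r s ≤
            (SkewNormal.corrMatrix V' ⊗ₖ SkewNormal.corrMatrix S') r s)) ∧
    (SkewNormal.SameMarginals P P' X₀ Y₀ →
      SkewNormal.skewDelta (SkewNormal.corrMatrix V) (SkewNormal.corrMatrix S) B =
        SkewNormal.skewDelta (SkewNormal.corrMatrix V') (SkewNormal.corrMatrix S') B') := by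
  have h1 : SkewNormal.SmoothSupermodularOrder P P' X₀ Y₀ →
      (SkewNormal.SameMarginals P P' X₀ Y₀ ∧ ∀ r s : Fin p × Fin n,
          (SkewNormal.corrMatrix V ⊗ₖ SkewNormal.corrMatrix S) r s ≤
            (SkewNormal.corrMatrix V' ⊗ₖ SkewNormal.corrMatrix S') r s) := fun h =>
    ⟨h.sameMarginals hX₀.aemeasurable hY₀.aemeasurable,
      h.corrMatrix_le hV hS hV' hS' hX₀ hY₀⟩
  have h2 : (SkewNormal.SameMarginals P P' X₀ Y₀ ∧ ∀ r s : Fin p × Fin n,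
          (SkewNormal.corrMatrix V ⊗ₖ SkewNormal.corrMatrix S) r s ≤
            (SkewNormal.corrMatrix V' ⊗ₖ SkewNormal.corrMatrix S') r s) →
      SkewNormal.SupermodularOrder P P' X₀ Y₀ := fun h =>
    h.1.supermodularOrder hV hS hV' hS' hX₀ hY₀ h.2
  -- The cycle full order, smooth order, conditions, full order gives both equivalences.
  refine ⟨⟨fun h => h1 h.smooth, h2⟩, ⟨h1, fun h => (h2 h).smooth⟩, fun h => ?_⟩
  rw [SkewNormal.skewDelta_eq_skewDir hV hS, SkewNormal.skewDelta_eq_skewDir hV' hS']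
  exact h.skewDir_eq hV hS hV' hS' hX₀ hY₀
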